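/- **Setting.** Let $d\ge 1$, $k\ge 0$ be integers, $\beta_1\in\mathbb R$, and let $\Omega\subset\mathbb R^d$ be a bounded domain. A rectangular mesh $\mathcal T_h$ of $\Omega$ is a finite set of closed axis-parallel boxes $K$ with nonempty, pairwise disjoint interiors such that $\Omega$ is the interior of $\bigcup_K K$. Let $\partial\Omega_D\subset\partial\Omega$ and $\partial\Omega_N=\partial\Omega\setminus\partial\Omega_D$; the mesh resolves $\partial\Omega_D$ if $\partial\Omega_D$ is a union of closed faces of cells. Let $\Gamma^0$ be the set of interior interfaces $e=K_1\cap K_2$ (of dimension $d-1$), with unit normal $n$ (along a coordinate axis) oriented from $K_1$ to $K_2$, $[w]=w|_{K_2}-w|_{K_1}$ and $\{w\}=\frac12(w|_{K_1}+w|_{K_2})$ on $e$. Let $h_e$ be the average of the widths of $K_1,K_2$ in direction $n$ (on a boundary face, the width of the cell in normal direction), and let $\mathbf n$ be the exterior unit normal on $\partial\Omega$. For $\kappa\in\mathbb R$ we say that the mesh has ratio bound $\kappa$ if for any two cells sharing an interface, each of their two widths in the direction normal to it is at most $\kappa$ times the other. Let $V_h$ be the space of functions that on each cell are polynomials of total degree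 at most $k$, and $\|\cdot\|$ the $L^2(\Omega)$ norm. For charges $q_1,\dots,q_m\in\mathbb R$, integrable data $\rho_0$ on $\Omega$, $\psi_D$ on $\partial\Omega_D$, $\sigma$ on $\partial\Omega_N$, and $c_{1h},\dots,c_{mh}\in V_h$, the DDG scheme for $-\Delta\psi=\sum_i q_ic_i+\rho_0$, $\psi=\psi_D$ on $\partial\Omega_D$, $\partial_{\mathbf n}\psi=\sigma$ on $\partial\Omega_N$, is: find $\psi_h\in V_h$ with $$A(\psi_h,\eta)=L(c_{ih},\eta)\qquad\forall\eta\in V_h,$$ where, with $\widehat{\partial_n w}=\beta_0\frac{[w]}{h_e}+\{\partial_n w\}+\beta_1h_e[\partial_n^2w]$, $$A(\psi,\eta)=\sum_K\int_K\nabla\psi\cdot\nabla\eta\,dx+\sum_{e\in\Gamma^0}\int_e\big(\widehat{\partial_n\psi}[\eta]+\{\partial_n\eta\}[\psi]\big)ds+\int_{\partial\Omega_D}\Big(\big(\tfrac{\beta_0}{h_e}\psi-\partial_{\mathbf n}\psi\big)\eta-\psi\,\partial_{\mathbf n}\eta\Big)ds,$$ $$L(c_{ih},\eta)=\sum_K\int_K\Big(\sum_{i=1}^mq_ic_{ih}+\rho_0\Big)\eta\,dx+\int_{\partial\Omega_D}\big(\tfrac{\beta_0}{h_e}\eta-\partial_{\mathbf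 n}\eta\big)\psi_D\,ds+\int_{\partial\Omega_N}\sigma\eta\,ds.$$ **Theorem 3.2.** For all $d,k,\beta_1,\kappa$ there is a number $\beta_0^*>1$, depending only on these, such that the following holds; moreover, for $\kappa=1$ (uniform meshes), $d\le 2$ and $k\ge1$ one may take $\beta_0^*=\max\{\Gamma(\beta_1),2\Gamma(0)\}$ with $\Gamma(\beta_1)=k^2\big(1-\beta_1(k^2-1)+\frac{\beta_1^2}{3}(k^2-1)^2\big)$. Let $\beta_0>\beta_0^*$, let $\Omega$ be a bounded domain and let $\partial\Omega_D\subset\partial\Omega$ with $\partial\Omega_D\neq\emptyset$. Then there is a constant $C>0$ such that for every rectangular mesh $\mathcal T_h$ of $\Omega$ with ratio bound $\kappa$ that resolves $\partial\Omega_D$, and for all $m$, $q_i$, $\rho_0$, $\psi_D$, $\sigma$ as above: 1. for given $c_{ih}\in V_h$ ($i=1,\dots,m$) the DDG scheme has a unique solution $\psi_h\in V_h$; 2. if $\psi_h$ and $\tilde\psi_h$ are the solutions for $c_{ih}$ and $\tilde c_{ih}$ respectively, then $$\|\psi_h-\tilde\psi_h\|\le C\sum_{i=1}^m|q_i|\,\|c_{ih}-\tilde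 c_{ih}\|.$$ In particular, $C$ is independent of the mesh and of the mesh size $h$. -/

import Mathlib

open MeasureTheory

/-! The direct discontinuous Galerkin (DDG) method for the Poisson equation on rectangular meshes of
a domain in `ℝ^d`, `d = n + 1`. -/

noncomputable section

namespace DDG

open BoxIntegral

/-- A mesh of `Ω ⊆ ℝ^(n+1)` by finitely many nondegenerate axis-parallel closed boxes with pairwise
disjoint interiors, whose union has interior `Ω`. Neighbouring cells need not share a full face. -/
structure RectMesh {n : ℕ} (Ω : Set (Fin (n + 1) → ℝ)) where
  numCells : ℕ
  cell : Fin numCells → Box (Fin (n + 1))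
  interior_union : Ω = interior (⋃ K, Box.Icc (cell K))
  disjoint_cells : ∀ K K', K ≠ K' → Disjoint (Box.Ioo (cell K)) (Box.Ioo (cell K'))

/-- Side length of a box in direction `j`. -/
def width {n : ℕ} (B : Box (Fin (n + 1))) (j : Fin (n + 1)) : ℝ := B.upper j - B.lower j

/-- The `j`-th coordinate of the upper (`s = true`) or lower (`s = false`) face orthogonal to the
`j`-th axis. -/
def faceCoord {n : ℕ} (B : Box (Fin (n + 1))) (j : Fin (n + 1)) (s : Bool) : ℝ :=
  if s then B.upper j else B.lower j

/-- The point of the hyperplane `x_j = faceCoord B j s` with remaining coordinates `y`. -/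
def facePoint {n : ℕ} (B : Box (Fin (n + 1))) (j : Fin (n + 1)) (s : Bool) (y : Fin n → ℝ) :
    Fin (n + 1) → ℝ :=
  j.insertNth (faceCoord B j s) y

/-- The closed face of `B` orthogonal to the `j`-th axis, on the side `s`. -/
def closedFace {n : ℕ} (B : Box (Fin (n + 1))) (j : Fin (n + 1)) (s : Bool) :
    Set (Fin (n + 1) → ℝ) :=
  facePoint B j s '' Box.Icc (B.face j)

/-- The `j`-th component of the exterior unit normal on the face `(j, s)`. -/
def normalSign (s : Bool) : ℝ := if s then 1 else -1

/-- `K₁` and `K₂` share an interface with normal `e_j` pointing from `K₁` to `K₂`. -/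
def Adjacent {n : ℕ} (K₁ K₂ : Box (Fin (n + 1))) (j : Fin (n + 1)) : Prop :=
  K₁.upper j = K₂.lower j ∧ (Box.Ioo (K₁.face j) ∩ Box.Ioo (K₂.face j)).Nonempty

namespace RectMesh

variable {n : ℕ} {Ω : Set (Fin (n + 1) → ℝ)}

/-- The widths, in normal direction, of any two cells that share an interface differ at most by the
factor `κ`. For `κ = 1` the mesh is uniform. -/
def RatioBound (T : RectMesh Ω) (κ : ℝ) : Prop :=
  ∀ K₁ K₂ j, Adjacent (T.cell K₁) (T.cell K₂) j →
    width (T.cell K₁) j ≤ κ * width (T.cell K₂) j ∧ width (T.cell K₂) j ≤ κ * width (T.cell K₁) j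

/-- The boundary part `Γ` is a union of faces of the mesh. -/
def Resolves (T : RectMesh Ω) (Γ : Set (Fin (n + 1) → ℝ)) : Prop :=
  ∀ x ∈ Γ, ∃ K j s, x ∈ closedFace (T.cell K) j s ∧ closedFace (T.cell K) j s ⊆ Γ

/-- The space `V_h`: a polynomial of total degree at most `k` on each cell, independently. -/
abbrev Space (T : RectMesh Ω) (k : ℕ) : Type :=
  Fin T.numCells → MvPolynomial.restrictTotalDegree (Fin (n + 1)) ℝ k

variable {T : RectMesh Ω} {k : ℕ}

/-- Value at `x` of the polynomial that represents `v` on the cell `K`. -/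
def val (v : T.Space k) (K : Fin T.numCells) (x : Fin (n + 1) → ℝ) : ℝ :=
  MvPolynomial.eval x (v K : MvPolynomial (Fin (n + 1)) ℝ)

/-- `∂_j v` on the cell `K`. -/
def d1 (v : T.Space k) (K : Fin T.numCells) (j : Fin (n + 1)) (x : Fin (n + 1) → ℝ) : ℝ :=
  MvPolynomial.eval x (MvPolynomial.pderiv j (v K : MvPolynomial (Fin (n + 1)) ℝ))

/-- `∂_j² v` on the cell `K`. -/
def d2 (v : T.Space k) (K : Fin T.numCells) (j : Fin (n + 1)) (x : Fin (n + 1) → ℝ) : ℝ :=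
  MvPolynomial.eval x
    (MvPolynomial.pderiv j (MvPolynomial.pderiv j (v K : MvPolynomial (Fin (n + 1)) ℝ)))

/-- The `L²(Ω)` norm on `V_h`. -/
def l2norm (v : T.Space k) : ℝ :=
  Real.sqrt (∑ K, ∫ x in Box.Icc (T.cell K), val v K x ^ 2)

/-- The mean of the normal widths of the two cells at an interface. -/
def hInterface (T : RectMesh Ω) (K₁ K₂ : Fin T.numCells) (j : Fin (n + 1)) : ℝ :=
  (width (T.cell K₁) j + width (T.cell K₂) j) / 2

/-- `[v]` at an interface. -/
def jump (v : T.Space k) (K₁ K₂ : Fin T.numCells) (x : Fin (n + 1) → ℝ) : ℝ :=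
  val v K₂ x - val v K₁ x

/-- `{∂_n v}` at an interface with normal `n = e_j`. -/
def avgD1 (v : T.Space k) (K₁ K₂ : Fin T.numCells) (j : Fin (n + 1)) (x : Fin (n + 1) → ℝ) : ℝ :=
  (d1 v K₁ j x + d1 v K₂ j x) / 2

/-- `[∂_n² v]` at an interface with normal `n = e_j`. -/
def jumpD2 (v : T.Space k) (K₁ K₂ : Fin T.numCells) (j : Fin (n + 1)) (x : Fin (n + 1) → ℝ) : ℝ :=
  d2 v K₂ j x - d2 v K₁ j x

/-- The numerical flux `β₀ [v] / h_e + {∂_n v} + β₁ h_e [∂_n² v]` at an interface. -/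
def flux (β₀ β₁ : ℝ) (v : T.Space k) (K₁ K₂ : Fin T.numCells) (j : Fin (n + 1))
    (x : Fin (n + 1) → ℝ) : ℝ :=
  β₀ * jump v K₁ K₂ x / T.hInterface K₁ K₂ j + avgD1 v K₁ K₂ j x
    + β₁ * T.hInterface K₁ K₂ j * jumpD2 v K₁ K₂ j x

open Classical in
/-- `∑_{e ∈ Γ⁰} ∫_e f ds`. Each interface is listed once, with its normal in the positive direction
of a coordinate axis; the integrands used below do not depend on the orientation. -/
def interfaceIntegral (T : RectMesh Ω)
    (f : Fin T.numCells → Fin T.numCells → Fin (n + 1) → (Fin (n + 1) → ℝ) → ℝ) : ℝ :=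
  ∑ j, ∑ K₁, ∑ K₂,
    if Adjacent (T.cell K₁) (T.cell K₂) j then
      ∫ y in Box.Icc ((T.cell K₁).face j) ∩ Box.Icc ((T.cell K₂).face j),
        f K₁ K₂ j (facePoint (T.cell K₁) j true y)
    else 0

/-- Parameters `y` of the points of the face `(j, s)` of the cell `K` that lie in `Γ`. -/
def faceIn (T : RectMesh Ω) (Γ : Set (Fin (n + 1) → ℝ)) (K : Fin T.numCells) (j : Fin (n + 1))
    (s : Bool) : Set (Fin n → ℝ) :=
  Box.Icc ((T.cell K).face j) ∩ {y | facePoint (T.cell K) j s y ∈ Γ}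

/-- `∫_Γ f ds` for a part `Γ` of the boundary of `Ω`. -/
def boundaryIntegral (T : RectMesh Ω) (Γ : Set (Fin (n + 1) → ℝ))
    (f : Fin T.numCells → Fin (n + 1) → Bool → (Fin (n + 1) → ℝ) → ℝ) : ℝ :=
  ∑ K, ∑ j, ∑ s, ∫ y in T.faceIn Γ K j s, f K j s (facePoint (T.cell K) j s y)

/-- `g` is integrable on the part `Γ` of the boundary of `Ω`. -/
def BoundaryIntegrable (T : RectMesh Ω) (Γ : Set (Fin (n + 1) → ℝ)) (g : (Fin (n + 1) → ℝ) → ℝ) :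
    Prop :=
  ∀ K j s, IntegrableOn (fun y => g (facePoint (T.cell K) j s y)) (T.faceIn Γ K j s)

/-- The bilinear form `A(ψ, η)`, with Dirichlet part `ΓD` of the boundary. -/
def formA (ΓD : Set (Fin (n + 1) → ℝ)) (β₀ β₁ : ℝ) (ψ η : T.Space k) : ℝ :=
  (∑ K, ∫ x in Box.Icc (T.cell K), ∑ j, d1 ψ K j x * d1 η K j x)
  + T.interfaceIntegral (fun K₁ K₂ j x =>
      flux β₀ β₁ ψ K₁ K₂ j x * jump η K₁ K₂ x + avgD1 η K₁ K₂ j x * jump ψ K₁ K₂ x)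
  + T.boundaryIntegral ΓD (fun K j s x =>
      (β₀ / width (T.cell K) j * val ψ K x - normalSign s * d1 ψ K j x) * val η K x
        - val ψ K x * (normalSign s * d1 η K j x))

/-- The functional `L(c, η)`, with charges `q`, source `ρ₀`, Dirichlet data `ψD` on `ΓD` and Neumann
data `σ` on `∂Ω \ ΓD`. -/
def formL (ΓD : Set (Fin (n + 1) → ℝ)) (β₀ : ℝ) {m : ℕ} (q : Fin m → ℝ)
    (ρ₀ ψD σ : (Fin (n + 1) → ℝ) → ℝ) (c : Fin m → T.Space k) (η : T.Space k) : ℝ :=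
  (∑ K, ∫ x in Box.Icc (T.cell K), ((∑ i, q i * val (c i) K x) + ρ₀ x) * val η K x)
  + T.boundaryIntegral ΓD (fun K j s x =>
      (β₀ / width (T.cell K) j * val η K x - normalSign s * d1 η K j x) * ψD x)
  + T.boundaryIntegral (frontier Ω \ ΓD) (fun K _ _ x => σ x * val η K x)

/-- `ψ ∈ V_h` solves the DDG scheme `A(ψ, η) = L(c, η)` for all `η ∈ V_h`. -/
def IsSolution (ΓD : Set (Fin (n + 1) → ℝ)) (β₀ β₁ : ℝ) {m : ℕ} (q : Fin m → ℝ)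
    (ρ₀ ψD σ : (Fin (n + 1) → ℝ) → ℝ) (c : Fin m → T.Space k) (ψ : T.Space k) : Prop :=
  ∀ η : T.Space k, formA ΓD β₀ β₁ ψ η = formL ΓD β₀ q ρ₀ ψD σ c η

end RectMesh

/-- `k² (1 - β₁ (k² - 1) + β₁² (k² - 1)² / 3)`. -/
def Gam (k : ℕ) (β₁ : ℝ) : ℝ :=
  (k : ℝ) ^ 2 * (1 - β₁ * ((k : ℝ) ^ 2 - 1) + β₁ ^ 2 / 3 * ((k : ℝ) ^ 2 - 1) ^ 2)

end DDG

end

/-! Restricting everything to lines parallel to the coordinate axes splits, by Fubini, both the form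
`A` and the energy (broken gradient plus `h_e⁻¹`-weighted jumps), so coercivity of `A` is a
one-dimensional question. On a segment of length `w`, a polynomial `u` of degree at most `k`
satisfies `w (u' ∓ β w u'')² ≤ Gam k β ∫ u'²` at the endpoints, as the expansion of `u'` in Legendre
polynomials shows; for `β₀` above the resulting threshold this absorbs the flux terms.

It remains to bound the `L²` norm by the energy with a constant that ignores the mesh. The variation
of a function along a line is bounded by the energy of that line, however the line is subdivided. So
the `L²` norm near a Dirichlet face is controlled, control passes between overlapping boxes by
moving along one axis at a time, and by connectedness it reaches all cells of one fixed mesh. -/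

noncomputable section

namespace DDG

open Polynomial BoxIntegral Set

variable {n : ℕ} {Ω : Set (Fin (n + 1) → ℝ)}

/-! ### A sharp trace inequality for polynomials -/

theorem add_sq_le_of_sq_le_mul {x y g₁ g₂ u₁ u₂ : ℝ} (hg₁ : 0 ≤ g₁) (hg₂ : 0 ≤ g₂) (hu₁ : 0 ≤ u₁)
    (hu₂ : 0 ≤ u₂) (hx : x ^ 2 ≤ g₁ * u₁) (hy : y ^ 2 ≤ g₂ * u₂) :
    (x + y) ^ 2 ≤ (g₁ + g₂) * (u₁ + u₂) := by
  simpa [Fin.sum_univ_two] using Finset.sum_sq_le_sum_mul_sum_of_sq_le_mul Finset.univ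
    (r := ![x, y]) (f := ![g₁, g₂]) (g := ![u₁, u₂]) (by simp [Fin.forall_fin_two, hg₁, hg₂])
    (by simp [Fin.forall_fin_two, hu₁, hu₂]) (by simp [Fin.forall_fin_two, hx, hy])

theorem intervalIntegrable_eval (p : ℝ[X]) (a b : ℝ) :
    IntervalIntegrable (fun x => p.eval x) volume a b :=
  p.continuous.intervalIntegrable a b

theorem integral_derivative_eval (p : ℝ[X]) (a b : ℝ) :
    ∫ x in a..b, (derivative p).eval x = p.eval b - p.eval a :=
  intervalIntegral.integral_eq_sub_of_hasDerivAt (fun x _ => p.hasDerivAt x)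
    (intervalIntegrable_eval _ a b)

/-- Integration over `[0, 1]` as a linear functional on polynomials. -/
def unitIntegral : ℝ[X] →ₗ[ℝ] ℝ where
  toFun p := ∫ x in (0 : ℝ)..1, p.eval x
  map_add' p q := by
    simp only [eval_add]
    exact intervalIntegral.integral_add (intervalIntegrable_eval _ _ _)
      (intervalIntegrable_eval _ _ _)
  map_smul' c p := by simp

theorem unitIntegral_apply (p : ℝ[X]) : unitIntegral p = ∫ x in (0 : ℝ)..1, p.eval x := rfl

theorem unitIntegral_derivative (p : ℝ[X]) :
    unitIntegral (derivative p) = p.eval 1 - p.eval 0 := integral_derivative_eval p 0 1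

theorem unitIntegral_mul_self_nonneg (p : ℝ[X]) : 0 ≤ unitIntegral (p * p) := by
  refine intervalIntegral.integral_nonneg zero_le_one fun x _ => ?_
  rw [eval_mul]
  exact mul_self_nonneg _

/-- The shifted Legendre polynomial with real coefficients. -/
def legendre (m : ℕ) : ℝ[X] := (shiftedLegendre m).map (Int.castRingHom ℝ)

theorem natDegree_legendre (m : ℕ) : (legendre m).natDegree = m := by
  rw [legendre, natDegree_map_eq_of_injective (RingHom.injective_int _), natDegree_shiftedLegendre]

theorem eval_zero_legendre (m : ℕ) : (legendre m).eval 0 = 1 := by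
  rw [← coeff_zero_eq_eval_zero, legendre, coeff_map, coeff_shiftedLegendre]
  simp

theorem eval_zero_derivative_legendre (m : ℕ) :
    (derivative (legendre m)).eval 0 = -((m : ℝ) * (m + 1)) := by
  rw [← coeff_zero_eq_eval_zero, coeff_derivative, legendre, coeff_map, coeff_shiftedLegendre]
  simp

theorem coeff_legendre_self_ne_zero (m : ℕ) : (legendre m).coeff m ≠ 0 := by
  have h0 : legendre m ≠ 0 := fun h => by simpa [h] using eval_zero_legendre m
  simpa [leadingCoeff, natDegree_legendre] using leadingCoeff_ne_zero.mpr h0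

theorem factorial_mul_legendre (m : ℕ) :
    C (m.factorial : ℝ) * legendre m = derivative^[m] (X ^ m * (1 - X) ^ m) := by
  have h := congrArg (Polynomial.map (Int.castRingHom ℝ)) (factorial_mul_shiftedLegendre_eq m)
  rw [← iterate_derivative_map] at h
  simpa [legendre] using h

theorem unitIntegral_iterate_derivative_mul {m j : ℕ} (hj : j ≤ m) (q : ℝ[X]) :
    unitIntegral (derivative^[j] (X ^ m * (1 - X) ^ m) * q)
      = (-1) ^ j * unitIntegral (X ^ m * (1 - X) ^ m * derivative^[j] q) := by
  induction j generalizing q with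
  | zero => simp
  | succ j ih =>
    set f : ℝ[X] := X ^ m * (1 - X) ^ m with hf
    have hroot : ∀ p : ℝ[X], p ^ m ∣ f → p ∣ derivative^[j] f := fun p hp =>
      (dvd_pow_self p (by omega)).trans (pow_sub_dvd_iterate_derivative_of_pow_dvd j hp)
    have h0 : (derivative^[j] f).eval 0 = 0 :=
      eval_eq_zero_of_dvd_of_eval_eq_zero (hroot X ⟨_, hf⟩) (by simp)
    have h1 : (derivative^[j] f).eval 1 = 0 :=
      eval_eq_zero_of_dvd_of_eval_eq_zero (hroot (1 - X) ⟨X ^ m, by rw [hf, mul_comm]⟩) (by simp)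
    have hparts := unitIntegral_derivative (derivative^[j] f * q)
    rw [derivative_mul, map_add, eval_mul, eval_mul, h0, h1] at hparts
    rw [Function.iterate_succ_apply', Function.iterate_succ_apply]
    have hj := ih (by omega) (derivative q)
    rw [pow_succ]
    linarith

theorem unitIntegral_legendre_mul {m : ℕ} {q : ℝ[X]} (hq : q.degree < m) :
    unitIntegral (legendre m * q) = 0 := by
  have h := unitIntegral_iterate_derivative_mul le_rfl q (m := m)
  rw [iterate_derivative_eq_zero_of_degree_lt hq, mul_zero, map_zero, mul_zero,
    ← factorial_mul_legendre, mul_assoc, ← smul_eq_C_mul, map_smul, smul_eq_mul] at h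
  exact (mul_eq_zero.mp h).resolve_left (by exact_mod_cast m.factorial_ne_zero)

theorem degree_sub_C_mul_legendre_lt {m : ℕ} {q : ℝ[X]} (hq : q.natDegree ≤ m) :
    (q - C (q.coeff m / (legendre m).coeff m) * legendre m).degree < m := by
  rw [degree_lt_iff_coeff_zero]
  intro i hi
  rcases hi.eq_or_lt with rfl | hi
  · simp [coeff_legendre_self_ne_zero]
  · rw [coeff_sub, coeff_C_mul, coeff_eq_zero_of_natDegree_lt (hq.trans_lt hi),
      coeff_eq_zero_of_natDegree_lt ((natDegree_legendre m).trans_lt hi)]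
    simp

theorem degree_X_sub_one_mul_derivative_sub_lt {m : ℕ} {q : ℝ[X]} (hq : q.natDegree ≤ m) :
    ((X - 1) * derivative q - C (m : ℝ) * q).degree < (m : WithBot ℕ) := by
  rw [degree_lt_iff_coeff_zero]
  intro i hi
  have hc : ∀ j, m < j → q.coeff j = 0 := fun j hj =>
    coeff_eq_zero_of_natDegree_lt (hq.trans_lt hj)
  rw [coeff_sub, coeff_C_mul, sub_mul, coeff_sub, one_mul, coeff_derivative, hc (i + 1) (by omega)]
  rcases i with _ | i
  · obtain rfl : m = 0 := by omega
    simp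
  · rw [coeff_X_mul, coeff_derivative]
    rcases hi.eq_or_lt with h | h
    · rw [h]; push_cast; ring
    · rw [hc _ h]; simp

theorem unitIntegral_legendre_mul_self (m : ℕ) :
    (2 * (m : ℝ) + 1) * unitIntegral (legendre m * legendre m) = 1 := by
  -- Integrate `((X - 1) L²)' = L² + 2 L (X - 1) L'`; modulo lower degree `(X - 1) L'` is `m L`.
  have hparts := unitIntegral_derivative ((X - 1) * (legendre m * legendre m))
  have horth := unitIntegral_legendre_mul
    (degree_X_sub_one_mul_derivative_sub_lt (natDegree_legendre m).le)
  rw [mul_sub, map_sub, mul_left_comm _ (C _), ← smul_eq_C_mul, map_smul, smul_eq_mul] at horth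
  have hexp : derivative ((X - 1) * (legendre m * legendre m)) = legendre m * legendre m
      + (2 : ℝ) • (legendre m * ((X - 1) * derivative (legendre m))) := by
    simp only [derivative_mul, derivative_sub, derivative_X, derivative_one, smul_eq_C_mul,
      map_ofNat]
    ring
  rw [hexp, map_add, map_smul, smul_eq_mul] at hparts
  simp only [eval_mul, eval_sub, eval_X, eval_one, eval_zero_legendre] at hparts
  linarith

theorem Gam_succ (m : ℕ) (c : ℝ) :
    Gam (m + 1) c = Gam m c + (2 * (m : ℝ) + 1) * (1 - c * ((m : ℝ) * (m + 1))) ^ 2 := by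
  simp only [Gam]
  push_cast
  ring

theorem Gam_nonneg (m : ℕ) (c : ℝ) : 0 ≤ Gam m c := by
  induction m with
  | zero => simp [Gam]
  | succ m ih => rw [Gam_succ]; positivity

theorem sq_eval_zero_le (c : ℝ) {k : ℕ} {q : ℝ[X]} (hq : q.degree < k) :
    (q.eval 0 + c * (derivative q).eval 0) ^ 2 ≤ Gam k c * unitIntegral (q * q) := by
  induction k generalizing q with
  | zero =>
    have : q = 0 := by simpa using hq
    simp [this]
  | succ m ih =>
    -- `q = r + a L` is an orthogonal splitting, so Cauchy-Schwarz adds the two constants.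
    set a : ℝ := q.coeff m / (legendre m).coeff m
    set r : ℝ[X] := q - C a * legendre m with hr
    have hrdeg : r.degree < m := degree_sub_C_mul_legendre_lt (natDegree_le_iff_degree_le.mpr
      (Order.lt_succ_iff.mp (by exact_mod_cast hq)))
    have hqr : q = r + C a * legendre m := by rw [hr]; ring
    have hnorm : unitIntegral (q * q)
        = unitIntegral (r * r) + a ^ 2 * unitIntegral (legendre m * legendre m) := by
      have hexp : q * q = r * r + (2 * a) • (legendre m * r)
          + (a ^ 2) • (legendre m * legendre m) := by
        rw [hqr]
        simp only [smul_eq_C_mul, map_mul, map_pow, map_ofNat]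
        ring
      simp [hexp, unitIntegral_legendre_mul hrdeg]
    have hval : q.eval 0 + c * (derivative q).eval 0 = (r.eval 0 + c * (derivative r).eval 0)
        + a * (1 - c * ((m : ℝ) * (m + 1))) := by
      rw [hqr]
      simp only [eval_add, eval_mul, eval_C, derivative_add, derivative_mul, derivative_C,
        eval_zero, eval_zero_legendre, eval_zero_derivative_legendre]
      ring
    rw [hval, hnorm, Gam_succ]
    refine add_sq_le_of_sq_le_mul (Gam_nonneg m c) (by positivity) (unitIntegral_mul_self_nonneg r)
      (mul_nonneg (sq_nonneg a) (unitIntegral_mul_self_nonneg _)) (ih hrdeg) (le_of_eq ?_)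
    linear_combination -(a * (1 - c * ((m : ℝ) * (m + 1)))) ^ 2 * unitIntegral_legendre_mul_self m

theorem unitIntegral_comp_mul_self (p : ℝ[X]) (a h : ℝ) :
    h * unitIntegral (p.comp (C a + C h * X) * p.comp (C a + C h * X))
      = ∫ x in a..a + h, p.eval x ^ 2 := by
  have := intervalIntegral.mul_integral_comp_add_mul (a := 0) (b := 1)
    (f := fun x => p.eval x ^ 2) h a
  simpa [unitIntegral_apply, sq] using this

theorem degree_comp_affine_lt {p : ℝ[X]} {k : ℕ} (hp : p.degree < k) (a h : ℝ) :
    (p.comp (C a + C h * X)).degree < k := by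
  rcases eq_or_ne p 0 with rfl | h0
  · simp
  refine degree_le_natDegree.trans_lt (Nat.cast_lt.mpr (natDegree_comp_le.trans_lt ?_))
  have hlin : (C a + C h * X : ℝ[X]).natDegree ≤ 1 := by compute_degree
  exact ((Nat.mul_le_mul_left _ hlin).trans_eq (mul_one _)).trans_lt
    ((natDegree_lt_iff_degree_lt h0).mpr hp)

theorem mul_sq_endpoint_le {p : ℝ[X]} {k : ℕ} (hp : p.degree < k) (c e h : ℝ) :
    (p.eval e + c * (h * (derivative p).eval e)) ^ 2 * h ^ 2
      ≤ Gam k c * (h * ∫ x in e..e + h, p.eval x ^ 2) := by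
  have hz := sq_eval_zero_le c (degree_comp_affine_lt hp e h)
  simp only [eval_comp, derivative_comp, eval_add, eval_mul, eval_C, eval_X, mul_zero, add_zero,
    derivative_add, derivative_mul, derivative_C, derivative_X, zero_mul, mul_one, zero_add] at hz
  rw [← unitIntegral_comp_mul_self p e h]
  calc _ ≤ Gam k c * unitIntegral (p.comp (C e + C h * X) * p.comp (C e + C h * X)) * h ^ 2 := by
        gcongr
    _ = _ := by ring

theorem width_mul_sq_left_le {p : ℝ[X]} {k : ℕ} (hp : p.degree < k) (c : ℝ) {a b : ℝ}
    (hab : a < b) :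
    (b - a) * (p.eval a + c * ((b - a) * (derivative p).eval a)) ^ 2
      ≤ Gam k c * ∫ x in a..b, p.eval x ^ 2 := by
  have h := mul_sq_endpoint_le hp c a (b - a)
  rw [add_sub_cancel] at h
  refine le_of_mul_le_mul_left ?_ (sub_pos.mpr hab)
  linarith

theorem width_mul_sq_right_le {p : ℝ[X]} {k : ℕ} (hp : p.degree < k) (c : ℝ) {a b : ℝ}
    (hab : a < b) :
    (b - a) * (p.eval b - c * ((b - a) * (derivative p).eval b)) ^ 2
      ≤ Gam k c * ∫ x in a..b, p.eval x ^ 2 := by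
  have h := mul_sq_endpoint_le hp c b (a - b)
  rw [add_sub_cancel, intervalIntegral.integral_symm] at h
  refine le_of_mul_le_mul_left ?_ (sub_pos.mpr hab)
  linarith

/-! ### Restriction to coordinate lines -/

/-- Restriction of a polynomial to the line in direction `j` through `y`, as a polynomial in the
`j`-th coordinate. -/
def linePoly (j : Fin (n + 1)) (y : Fin n → ℝ) : MvPolynomial (Fin (n + 1)) ℝ →ₐ[ℝ] ℝ[X] :=
  MvPolynomial.aeval (j.insertNth X (fun i => C (y i)) : Fin (n + 1) → ℝ[X])

theorem eval_linePoly (j : Fin (n + 1)) (y : Fin n → ℝ) (t : ℝ)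
    (P : MvPolynomial (Fin (n + 1)) ℝ) :
    (linePoly j y P).eval t = MvPolynomial.eval (j.insertNth t y : Fin (n + 1) → ℝ) P := by
  induction P using MvPolynomial.induction_on with
  | C a => simp [linePoly]
  | add p q hp hq => simp [hp, hq]
  | mul_X p i hp =>
    rw [map_mul, eval_mul, hp, map_mul]
    refine j.succAboveCases ?_ (fun i => ?_) i <;> simp [linePoly]

theorem derivative_linePoly (j : Fin (n + 1)) (y : Fin n → ℝ) (P : MvPolynomial (Fin (n + 1)) ℝ) :
    derivative (linePoly j y P) = linePoly j y (MvPolynomial.pderiv j P) := by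
  induction P using MvPolynomial.induction_on with
  | C a => simp
  | add p q hp hq => simp [hp, hq]
  | mul_X p i hp =>
    have hX : derivative (linePoly j y (MvPolynomial.X i))
        = linePoly j y (MvPolynomial.pderiv j (MvPolynomial.X i)) := by
      refine j.succAboveCases ?_ (fun i => ?_) i
      · simp [linePoly]
      · rw [MvPolynomial.pderiv_X_of_ne (Fin.succAbove_ne j i)]
        simp [linePoly]
    rw [map_mul, derivative_mul, hp, hX, Derivation.leibniz, map_add, smul_eq_mul, smul_eq_mul,
      map_mul, map_mul]
    ring

theorem natDegree_linePoly_le (j : Fin (n + 1)) (y : Fin n → ℝ) {k : ℕ}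
    (P : MvPolynomial.restrictTotalDegree (Fin (n + 1)) ℝ k) :
    (linePoly j y (P : MvPolynomial (Fin (n + 1)) ℝ)).natDegree ≤ k := by
  have h := MvPolynomial.aeval_natDegree_le (m := k) (n := 1) (P : MvPolynomial (Fin (n + 1)) ℝ)
    ((MvPolynomial.mem_restrictTotalDegree _ _ _).mp P.2)
    (j.insertNth X (fun i => C (y i)) : Fin (n + 1) → ℝ[X]) (fun i => by
      refine j.succAboveCases ?_ (fun i => ?_) i <;> simp)
  simpa [linePoly] using h

theorem degree_derivative_linePoly_lt (j : Fin (n + 1)) (y : Fin n → ℝ) {k : ℕ}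
    (P : MvPolynomial.restrictTotalDegree (Fin (n + 1)) ℝ k) :
    (derivative (linePoly j y (P : MvPolynomial (Fin (n + 1)) ℝ))).degree < k := by
  have h := natDegree_linePoly_le j y P
  rcases eq_or_ne (linePoly j y (P : MvPolynomial (Fin (n + 1)) ℝ)) 0 with h0 | h0
  · rw [h0, derivative_zero, degree_zero]
    exact WithBot.bot_lt_coe k
  · exact (degree_derivative_lt h0).trans_le (natDegree_le_iff_degree_le.mp h)

theorem continuous_insertNth (j : Fin (n + 1)) :
    Continuous fun q : ℝ × (Fin n → ℝ) => (j.insertNth q.1 q.2 : Fin (n + 1) → ℝ) :=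
  Continuous.finInsertNth (A := fun _ => ℝ) j continuous_fst continuous_snd

theorem insertNth_mem_Icc {B : Box (Fin (n + 1))} {j : Fin (n + 1)} {t : ℝ} {y : Fin n → ℝ} :
    (j.insertNth t y : Fin (n + 1) → ℝ) ∈ Box.Icc B ↔
      t ∈ Icc (B.lower j) (B.upper j) ∧ y ∈ Box.Icc (B.face j) := by
  rw [Box.Icc_def, Box.Icc_def, Fin.insertNth_mem_Icc]
  rfl

theorem mem_boxIoo {ι : Type*} {B : Box ι} {x : ι → ℝ} :
    x ∈ Box.Ioo B ↔ ∀ i, x i ∈ Ioo (B.lower i) (B.upper i) := by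
  rw [Box.Ioo]
  exact mem_univ_pi

theorem insertNth_mem_Ioo {B : Box (Fin (n + 1))} {j : Fin (n + 1)} {t : ℝ} {y : Fin n → ℝ} :
    (j.insertNth t y : Fin (n + 1) → ℝ) ∈ Box.Ioo B ↔
      t ∈ Ioo (B.lower j) (B.upper j) ∧ y ∈ Box.Ioo (B.face j) := by
  rw [mem_boxIoo, mem_boxIoo, Fin.forall_iff_succAbove j]
  simp [Box.face]

theorem isOpen_boxIoo {ι : Type*} [Finite ι] (B : Box ι) : IsOpen (Box.Ioo B) :=
  isOpen_set_pi finite_univ fun _ _ => isOpen_Ioo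

theorem measurableSet_boxIcc {ι : Type*} [Countable ι] (B : Box ι) : MeasurableSet (Box.Icc B) :=
  measurableSet_Icc

section Fubini

variable {E : Type*} [NormedAddCommGroup E] {A : Set (Fin (n + 1) → ℝ)} {s : Set ℝ}
  {u : Set (Fin n → ℝ)} {f : (Fin (n + 1) → ℝ) → E}

theorem preimage_piFinSuccAbove_symm {j : Fin (n + 1)}
    (hA : ∀ t y, (j.insertNth t y : Fin (n + 1) → ℝ) ∈ A ↔ t ∈ s ∧ y ∈ u) :
    (MeasurableEquiv.piFinSuccAbove (fun _ => ℝ) j).symm ⁻¹' A = s ×ˢ u :=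
  Set.ext fun q => hA q.1 q.2

theorem integrable_insertNth {j : Fin (n + 1)}
    (hA : ∀ t y, (j.insertNth t y : Fin (n + 1) → ℝ) ∈ A ↔ t ∈ s ∧ y ∈ u)
    (hf : IntegrableOn f A) :
    Integrable (fun q : ℝ × (Fin n → ℝ) => f (j.insertNth q.1 q.2))
      ((volume.restrict s).prod (volume.restrict u)) := by
  rw [Measure.prod_restrict, ← preimage_piFinSuccAbove_symm hA]
  exact (((volume_preserving_piFinSuccAbove (fun _ => ℝ) j).symm _).integrableOn_comp_preimage
    (MeasurableEquiv.measurableEmbedding _)).mpr hf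

theorem setIntegral_insertNth [NormedSpace ℝ E] {j : Fin (n + 1)}
    (hA : ∀ t y, (j.insertNth t y : Fin (n + 1) → ℝ) ∈ A ↔ t ∈ s ∧ y ∈ u)
    (hf : IntegrableOn f A) :
    ∫ x in A, f x = ∫ y in u, ∫ t in s, f (j.insertNth t y) := by
  rw [← integral_prod_symm _ (integrable_insertNth hA hf), Measure.prod_restrict,
    ← preimage_piFinSuccAbove_symm hA]
  exact (((volume_preserving_piFinSuccAbove (fun _ => ℝ) j).symm _).setIntegral_preimage_emb
    (MeasurableEquiv.measurableEmbedding _) f A).symm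

end Fubini

section FubiniBox

variable (B : Box (Fin (n + 1))) (j : Fin (n + 1)) {f : (Fin (n + 1) → ℝ) → ℝ}

theorem intervalIntegral_eq_setIntegral_Icc (g : ℝ → ℝ) :
    ∫ t in B.lower j..B.upper j, g t = ∫ t in Icc (B.lower j) (B.upper j), g t := by
  rw [intervalIntegral.integral_of_le (B.lower_lt_upper j).le, integral_Icc_eq_integral_Ioc]

theorem integrableOn_boxIcc {ι : Type*} [Fintype ι] (B : Box ι) {f : (ι → ℝ) → ℝ}
    (hf : Continuous f) : IntegrableOn f (Box.Icc B) :=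
  hf.continuousOn.integrableOn_compact B.isCompact_Icc

theorem integrableOn_intervalIntegral_insertNth (hf : Continuous f) :
    IntegrableOn (fun y => ∫ t in B.lower j..B.upper j, f (j.insertNth t y))
      (Box.Icc (B.face j)) := by
  simp only [intervalIntegral_eq_setIntegral_Icc]
  exact (integrable_insertNth (fun _ _ => insertNth_mem_Icc)
    (integrableOn_boxIcc B hf)).integral_prod_right

theorem setIntegral_boxIcc_insertNth (hf : Continuous f) :
    ∫ x in Box.Icc B, f x
      = ∫ y in Box.Icc (B.face j), ∫ t in B.lower j..B.upper j, f (j.insertNth t y) := by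
  simp only [intervalIntegral_eq_setIntegral_Icc]
  exact setIntegral_insertNth (fun _ _ => insertNth_mem_Icc) (integrableOn_boxIcc B hf)

end FubiniBox

namespace RectMesh

variable {T : RectMesh Ω} {k : ℕ}

section Line

variable (v : T.Space k) (K : Fin T.numCells) (j : Fin (n + 1)) (t : ℝ) (y : Fin n → ℝ)

/-- The polynomial that represents `v` on the cell `K`, restricted to a line in direction `j`. -/
def line : ℝ[X] := linePoly j y (v K : MvPolynomial (Fin (n + 1)) ℝ)

theorem val_insertNth : val v K (j.insertNth t y) = (line v K j y).eval t :=
  (eval_linePoly j y t _).symm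

theorem d1_insertNth : d1 v K j (j.insertNth t y) = (derivative (line v K j y)).eval t := by
  rw [line, derivative_linePoly, eval_linePoly, d1]

theorem d2_insertNth :
    d2 v K j (j.insertNth t y) = (derivative (derivative (line v K j y))).eval t := by
  rw [line, derivative_linePoly, derivative_linePoly, eval_linePoly, d2]

@[fun_prop]
theorem continuous_val : Continuous (val v K) :=
  MvPolynomial.continuous_eval _

@[fun_prop]
theorem continuous_d1 : Continuous (d1 v K j) :=
  MvPolynomial.continuous_eval _

@[fun_prop]
theorem continuous_d2 : Continuous (d2 v K j) :=
  MvPolynomial.continuous_eval _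

end Line

@[fun_prop]
theorem continuous_facePoint (B : Box (Fin (n + 1))) (j : Fin (n + 1)) (s : Bool) :
    Continuous (facePoint B j s) :=
  (continuous_insertNth j).comp (continuous_const.prodMk continuous_id)

/-! ### Sums over a mesh as integrals over lines -/

open Classical in
/-- The cells met in their interior by the line in direction `j` through `y`. -/
def lineCells (T : RectMesh Ω) (j : Fin (n + 1)) (y : Fin n → ℝ) : Finset (Fin T.numCells) :=
  {K | y ∈ Box.Ioo ((T.cell K).face j)}

theorem mem_lineCells {j : Fin (n + 1)} {y : Fin n → ℝ} {K : Fin T.numCells} :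
    K ∈ T.lineCells j y ↔ y ∈ Box.Ioo ((T.cell K).face j) := by
  simp [lineCells]

section SumLineCells

variable {j : Fin (n + 1)} {A : Set (Fin n → ℝ)} {g : Fin T.numCells → (Fin n → ℝ) → ℝ}

theorem sum_lineCells (y : Fin n → ℝ) :
    ∑ K ∈ T.lineCells j y, g K y
      = ∑ K, (Box.Ioo ((T.cell K).face j)).indicator (g K) y := by
  classical
  simp only [lineCells, Finset.sum_filter, indicator_apply]

theorem inter_boxIoo_ae_eq {ι : Type*} [Fintype ι] (A : Set (ι → ℝ)) (B : Box ι) :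
    (A ∩ Box.Ioo B : Set (ι → ℝ)) =ᵐ[volume] (A ∩ Box.Icc B : Set (ι → ℝ)) :=
  (ae_eq_refl A).inter (Box.Ioo_ae_eq_Icc B)

theorem integrableOn_indicator_boxIoo
    (hg : ∀ K, IntegrableOn (g K) (A ∩ Box.Icc ((T.cell K).face j))) (K : Fin T.numCells) :
    IntegrableOn ((Box.Ioo ((T.cell K).face j)).indicator (g K)) A := by
  rw [integrableOn_indicator_iff (isOpen_boxIoo _).measurableSet, inter_comm,
    integrableOn_congr_set_ae (inter_boxIoo_ae_eq _ _)]
  exact hg K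

theorem integrableOn_sum_lineCells
    (hg : ∀ K, IntegrableOn (g K) (A ∩ Box.Icc ((T.cell K).face j))) :
    IntegrableOn (fun y => ∑ K ∈ T.lineCells j y, g K y) A := by
  simp only [sum_lineCells]
  exact integrable_finsetSum _ fun K _ => integrableOn_indicator_boxIoo hg K

theorem setIntegral_sum_lineCells
    (hg : ∀ K, IntegrableOn (g K) (A ∩ Box.Icc ((T.cell K).face j))) :
    ∫ y in A, ∑ K ∈ T.lineCells j y, g K y
      = ∑ K, ∫ y in A ∩ Box.Icc ((T.cell K).face j), g K y := by
  simp only [sum_lineCells]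
  rw [integral_finsetSum _ fun K _ => integrableOn_indicator_boxIoo hg K]
  refine Finset.sum_congr rfl fun K _ => ?_
  rw [setIntegral_indicator (isOpen_boxIoo _).measurableSet,
    setIntegral_congr_set (inter_boxIoo_ae_eq _ _)]

end SumLineCells

/-- Continuous integrands on the cells (one per direction), the interfaces and the boundary faces of
a mesh: the common shape of the bilinear form and of the energy. -/
structure MeshIntegrand (T : RectMesh Ω) where
  cell : Fin T.numCells → Fin (n + 1) → (Fin (n + 1) → ℝ) → ℝ
  interface : Fin T.numCells → Fin T.numCells → Fin (n + 1) → (Fin (n + 1) → ℝ) → ℝ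
  boundary : Fin T.numCells → Fin (n + 1) → Bool → (Fin (n + 1) → ℝ) → ℝ
  continuous_cell : ∀ K j, Continuous (cell K j)
  continuous_interface : ∀ K₁ K₂ j, Continuous (interface K₁ K₂ j)
  continuous_boundary : ∀ K j s, Continuous (boundary K j s)

namespace MeshIntegrand

variable (F : MeshIntegrand T) (Γ : Set (Fin (n + 1) → ℝ)) (j : Fin (n + 1)) (y : Fin n → ℝ)

/-- The sum of the integrals of `F` over the cells, the interfaces and the boundary part `Γ`. -/
def meshSum : ℝ :=
  (∑ K, ∫ x in Box.Icc (T.cell K), ∑ j, F.cell K j x) + T.interfaceIntegral F.interface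
    + T.boundaryIntegral Γ F.boundary

/-- The contribution to the cell integrals of the line in direction `j` through `y`. -/
def lineCellSum : ℝ :=
  ∑ K ∈ T.lineCells j y, ∫ t in (T.cell K).lower j..(T.cell K).upper j,
    F.cell K j (j.insertNth t y)

/-- The contribution to the interface integrals of the line in direction `j` through `y`. -/
def lineInterfaceSum : ℝ :=
  ∑ K₁ ∈ T.lineCells j y, ∑ K₂ ∈ T.lineCells j y,
    if (T.cell K₁).upper j = (T.cell K₂).lower j then
      F.interface K₁ K₂ j (facePoint (T.cell K₁) j true y) else 0

/-- The contribution to the boundary integrals of the line in direction `j` through `y`. -/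
def lineBoundarySum : ℝ :=
  ∑ K ∈ T.lineCells j y, ∑ s, Γ.indicator (F.boundary K j s) (facePoint (T.cell K) j s y)

/-- The contribution to `F.meshSum Γ` of the line in direction `j` through `y`. -/
def lineSum : ℝ := F.lineCellSum j y + F.lineInterfaceSum j y + F.lineBoundarySum Γ j y

theorem integrableOn_cell (K : Fin T.numCells) :
    IntegrableOn (fun y => ∫ t in (T.cell K).lower j..(T.cell K).upper j,
      F.cell K j (j.insertNth t y)) (univ ∩ Box.Icc ((T.cell K).face j)) := by
  rw [univ_inter]
  exact integrableOn_intervalIntegral_insertNth _ j (F.continuous_cell K j)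

theorem integrable_lineCellSum : Integrable (F.lineCellSum j) :=
  integrableOn_univ.mp (integrableOn_sum_lineCells (F.integrableOn_cell j))

theorem integral_lineCellSum :
    ∫ y, F.lineCellSum j y = ∑ K, ∫ x in Box.Icc (T.cell K), F.cell K j x := by
  simp only [lineCellSum]
  rw [← setIntegral_univ, setIntegral_sum_lineCells (F.integrableOn_cell j)]
  exact Finset.sum_congr rfl fun K _ => by
    rw [univ_inter, setIntegral_boxIcc_insertNth _ j (F.continuous_cell K j)]

section Interface

theorem integrableOn_interface (K₁ K₂ : Fin T.numCells) :
    IntegrableOn (fun y => if (T.cell K₁).upper j = (T.cell K₂).lower j then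
      F.interface K₁ K₂ j (facePoint (T.cell K₁) j true y) else 0)
      (univ ∩ Box.Icc ((T.cell K₁).face j) ∩ Box.Icc ((T.cell K₂).face j)) := by
  split_ifs
  · exact (integrableOn_boxIcc ((T.cell K₂).face j) ((F.continuous_interface K₁ K₂ j).comp
      (continuous_facePoint (T.cell K₁) j true))).mono_set inter_subset_right
  · exact integrableOn_zero

open Classical in
theorem setIntegral_interface (K₁ K₂ : Fin T.numCells) :
    (∫ y in univ ∩ Box.Icc ((T.cell K₁).face j) ∩ Box.Icc ((T.cell K₂).face j),
      if (T.cell K₁).upper j = (T.cell K₂).lower j then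
        F.interface K₁ K₂ j (facePoint (T.cell K₁) j true y) else 0)
      = if Adjacent (T.cell K₁) (T.cell K₂) j then
          ∫ y in Box.Icc ((T.cell K₁).face j) ∩ Box.Icc ((T.cell K₂).face j),
            F.interface K₁ K₂ j (facePoint (T.cell K₁) j true y) else 0 := by
  by_cases hadj : Adjacent (T.cell K₁) (T.cell K₂) j
  · rw [univ_inter]
    simp only [hadj, hadj.1, if_true]
  rw [if_neg hadj]
  split_ifs with h
  · have hempty : Box.Ioo ((T.cell K₁).face j) ∩ Box.Ioo ((T.cell K₂).face j) = ∅ :=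
      not_nonempty_iff_eq_empty.mp fun hne => hadj ⟨h, hne⟩
    rw [univ_inter, ← setIntegral_congr_set
      ((Box.Ioo_ae_eq_Icc _).inter (Box.Ioo_ae_eq_Icc _)), hempty, setIntegral_empty]
  · exact integral_zero _ _

theorem integrable_lineInterfaceSum : Integrable (F.lineInterfaceSum j) :=
  integrableOn_univ.mp (integrableOn_sum_lineCells fun K₁ =>
    integrableOn_sum_lineCells (F.integrableOn_interface j K₁))

open Classical in
theorem integral_lineInterfaceSum :
    ∫ y, F.lineInterfaceSum j y = ∑ K₁, ∑ K₂, if Adjacent (T.cell K₁) (T.cell K₂) j then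
      ∫ y in Box.Icc ((T.cell K₁).face j) ∩ Box.Icc ((T.cell K₂).face j),
        F.interface K₁ K₂ j (facePoint (T.cell K₁) j true y) else 0 := by
  simp only [lineInterfaceSum]
  rw [← setIntegral_univ, setIntegral_sum_lineCells fun K₁ =>
    integrableOn_sum_lineCells (F.integrableOn_interface j K₁)]
  refine Finset.sum_congr rfl fun K₁ _ => ?_
  rw [setIntegral_sum_lineCells (F.integrableOn_interface j K₁)]
  exact Finset.sum_congr rfl fun K₂ _ => F.setIntegral_interface j K₁ K₂

end Interface

section Boundary

variable {Γ} (hΓ : MeasurableSet Γ)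

theorem integrableOn_comp_facePoint (K : Fin T.numCells) (s : Bool) :
    IntegrableOn (fun y => F.boundary K j s (facePoint (T.cell K) j s y))
      (Box.Icc ((T.cell K).face j)) :=
  integrableOn_boxIcc _ ((F.continuous_boundary K j s).comp (continuous_facePoint (T.cell K) j s))

include hΓ

theorem integrableOn_indicator_boundary (K : Fin T.numCells) (s : Bool) :
    IntegrableOn (fun y => Γ.indicator (F.boundary K j s) (facePoint (T.cell K) j s y))
      (univ ∩ Box.Icc ((T.cell K).face j)) := by
  rw [univ_inter]
  exact (F.integrableOn_comp_facePoint j K s).indicator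
    ((continuous_facePoint (T.cell K) j s).measurable hΓ)

theorem integrable_lineBoundarySum : Integrable (F.lineBoundarySum Γ j) :=
  integrableOn_univ.mp (integrableOn_sum_lineCells fun K =>
    integrable_finsetSum _ fun s _ => F.integrableOn_indicator_boundary j hΓ K s)

theorem integral_lineBoundarySum :
    ∫ y, F.lineBoundarySum Γ j y
      = ∑ K, ∑ s, ∫ y in T.faceIn Γ K j s, F.boundary K j s (facePoint (T.cell K) j s y) := by
  simp only [lineBoundarySum]
  rw [← setIntegral_univ, setIntegral_sum_lineCells fun K =>
    integrable_finsetSum _ fun s _ => F.integrableOn_indicator_boundary j hΓ K s]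
  refine Finset.sum_congr rfl fun K _ => ?_
  rw [integral_finsetSum _ fun s _ => F.integrableOn_indicator_boundary j hΓ K s]
  refine Finset.sum_congr rfl fun s _ => ?_
  rw [univ_inter]
  exact setIntegral_indicator ((continuous_facePoint (T.cell K) j s).measurable hΓ)

theorem integrable_lineSum : Integrable (F.lineSum Γ j) :=
  ((F.integrable_lineCellSum j).add (F.integrable_lineInterfaceSum j)).add
    (F.integrable_lineBoundarySum j hΓ)

theorem integral_lineSum :
    ∫ y, F.lineSum Γ j y
      = (∫ y, F.lineCellSum j y) + (∫ y, F.lineInterfaceSum j y)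
        + ∫ y, F.lineBoundarySum Γ j y := by
  rw [← integral_add' (F.integrable_lineCellSum j) (F.integrable_lineInterfaceSum j),
    ← integral_add' ((F.integrable_lineCellSum j).add (F.integrable_lineInterfaceSum j))
      (F.integrable_lineBoundarySum j hΓ)]
  rfl

theorem meshSum_eq_sum_integral_lineSum : F.meshSum Γ = ∑ j, ∫ y, F.lineSum Γ j y := by
  have hcell : ∑ K, ∫ x in Box.Icc (T.cell K), ∑ j, F.cell K j x
      = ∑ j, ∫ y, F.lineCellSum j y := by
    simp only [integral_lineCellSum]
    rw [Finset.sum_comm]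
    exact Finset.sum_congr rfl fun K _ => integral_finsetSum _ fun j _ =>
      integrableOn_boxIcc _ (F.continuous_cell K j)
  have hboundary : T.boundaryIntegral Γ F.boundary = ∑ j, ∫ y, F.lineBoundarySum Γ j y := by
    simp only [F.integral_lineBoundarySum _ hΓ, boundaryIntegral]
    exact Finset.sum_comm
  simp only [meshSum, hcell, hboundary, interfaceIntegral, ← integral_lineInterfaceSum,
    F.integral_lineSum _ hΓ, Finset.sum_add_distrib]

end Boundary

end MeshIntegrand

end RectMesh

/-! ### Families of intervals on the line -/

/-- Finitely many nondegenerate intervals `[a i, b i]` with pairwise disjoint interiors: the cells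
of a mesh that a line meets. -/
structure IsIntervalFamily {ι : Type*} (S : Finset ι) (a b : ι → ℝ) : Prop where
  lt : ∀ i ∈ S, a i < b i
  le_or_le : ∀ i ∈ S, ∀ i' ∈ S, i ≠ i' → b i ≤ a i' ∨ b i' ≤ a i

theorem sum_ite_add_ite_le {ι : Type*} {S : Finset ι} {P : ι → Prop} {Q : Prop} [DecidablePred P]
    [Decidable Q] {x : ℝ} (hx : 0 ≤ x) (hP : ∀ i ∈ S, ∀ i' ∈ S, P i → P i' → i = i')
    (hQ : ∀ i ∈ S, P i → ¬Q) :
    (∑ i ∈ S, if P i then x else 0) + (if Q then x else 0) ≤ x := by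
  by_cases h : ∃ i ∈ S, P i
  · obtain ⟨i, hi, hPi⟩ := h
    rw [Finset.sum_eq_single_of_mem i hi fun i' hi' hne =>
      if_neg fun h => hne (hP i' hi' i hi h hPi), if_pos hPi, if_neg (hQ i hi hPi), add_zero]
  · push Not at h
    rw [Finset.sum_eq_zero fun i hi => if_neg (h i hi), zero_add]
    split_ifs <;> linarith

theorem add_sum_sum_erase_le {ι : Type*} [DecidableEq ι] {S : Finset ι} {J : ι → ι → ℝ}
    (hJ : ∀ i i', 0 ≤ J i i') {i i' : ι} (hi : i ∈ S) (hi' : i' ∈ S) :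
    J i i' + ∑ i₁ ∈ S.erase i, ∑ i₂ ∈ S.erase i, J i₁ i₂ ≤ ∑ i₁ ∈ S, ∑ i₂ ∈ S, J i₁ i₂ := by
  rw [← Finset.add_sum_erase S (fun i₁ => ∑ i₂ ∈ S, J i₁ i₂) hi]
  exact add_le_add (Finset.single_le_sum (fun i₂ _ => hJ i i₂) hi')
    (Finset.sum_le_sum fun i₁ _ => Finset.sum_le_sum_of_subset_of_nonneg (Finset.erase_subset _ _)
      fun i₂ _ _ => hJ i₁ i₂)

theorem exists_left_endpoint_eq {ι : Type*} {S : Finset ι} {a b : ι → ℝ} {c d : ℝ} (hcd : c < d)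
    (hleft : ∀ i ∈ S, a i < c → b i ≤ c)
    (hcov : ∀ x ∈ Ioo c d, ∃ i ∈ S, x ∈ Icc (a i) (b i)) : ∃ i ∈ S, a i = c := by
  by_contra! hne
  -- A point just to the right of `c` precedes all left endpoints beyond `c`, so nothing covers it.
  obtain ⟨x, hx, hxa⟩ : ∃ x ∈ Ioo c d, ∀ i ∈ S, c < a i → x < a i := by
    have hev : ∀ᶠ x in nhdsWithin c (Ioi c), x ∈ Ioo c d ∧ ∀ i ∈ S, c < a i → x < a i := by
      refine Filter.Eventually.and (Ioo_mem_nhdsGT hcd)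
        ((Filter.eventually_all_finset S).mpr fun i _ => ?_)
      by_cases h : c < a i
      · filter_upwards [Ioo_mem_nhdsGT h] with x hx _ using hx.2
      · exact Filter.Eventually.of_forall fun x h' => absurd h' h
    exact hev.exists
  obtain ⟨i, hi, hxi⟩ := hcov x hx
  rcases lt_trichotomy (a i) c with h | h | h
  · exact absurd (hxi.2.trans (hleft i hi h)) (not_le.mpr hx.1)
  · exact hne i hi h
  · exact absurd (hxa i hi h) (not_lt.mpr hxi.1)

theorem exists_right_endpoint_eq {ι : Type*} {S : Finset ι} {a b : ι → ℝ} {c d : ℝ} (hcd : c < d)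
    (hright : ∀ i ∈ S, d < b i → d ≤ a i)
    (hcov : ∀ x ∈ Ioo c d, ∃ i ∈ S, x ∈ Icc (a i) (b i)) : ∃ i ∈ S, b i = d := by
  obtain ⟨i, hi, h⟩ := exists_left_endpoint_eq (S := S) (a := fun i => -b i) (b := fun i => -a i)
    (neg_lt_neg hcd) (fun i hi h => neg_le_neg (hright i hi (neg_lt_neg_iff.mp h)))
    (fun x hx => by
      obtain ⟨i, hi, h⟩ := hcov (-x) ⟨by linarith [hx.2], by linarith [hx.1]⟩
      exact ⟨i, hi, by linarith [h.2], by linarith [h.1]⟩)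
  exact ⟨i, hi, neg_injective h⟩

theorem sq_intervalIntegral_le {f : ℝ → ℝ} (hf : Continuous f) {a b : ℝ} (hab : a ≤ b) :
    (∫ x in a..b, f x) ^ 2 ≤ (b - a) * ∫ x in a..b, f x ^ 2 := by
  rcases hab.eq_or_lt with rfl | hlt
  · simp
  set δ := ∫ x in a..b, f x with hδ
  have hf' : IntervalIntegrable f volume a b := hf.intervalIntegrable a b
  have hf2 : IntervalIntegrable (fun x => f x ^ 2) volume a b := (hf.pow 2).intervalIntegrable a b
  have hvar : 0 ≤ ∫ x in a..b, ((b - a) * f x - δ) ^ 2 :=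
    intervalIntegral.integral_nonneg hab fun x _ => sq_nonneg _
  have hexp : ∫ x in a..b, ((b - a) * f x - δ) ^ 2
      = (b - a) * ((b - a) * (∫ x in a..b, f x ^ 2) - δ ^ 2) := by
    have hsq : ∀ x, ((b - a) * f x - δ) ^ 2
        = (b - a) ^ 2 * f x ^ 2 - 2 * (b - a) * δ * f x + δ ^ 2 := fun x => by ring
    simp only [hsq]
    rw [intervalIntegral.integral_add ((hf2.const_mul _).sub (hf'.const_mul _))
      intervalIntegrable_const, intervalIntegral.integral_sub (hf2.const_mul _) (hf'.const_mul _)]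
    simp only [intervalIntegral.integral_const_mul, intervalIntegral.integral_const, smul_eq_mul,
      ← hδ]
    ring
  rw [hexp] at hvar
  exact sub_nonneg.mp ((mul_nonneg_iff_of_pos_left (sub_pos.mpr hlt)).mp hvar)

theorem sq_eval_sub_le (p : ℝ[X]) {a b s t : ℝ} (hs : s ∈ Icc a b) (ht : t ∈ Icc a b) :
    (p.eval s - p.eval t) ^ 2 ≤ (b - a) * ∫ x in a..b, (derivative p).eval x ^ 2 := by
  wlog hst : s ≤ t generalizing s t
  · rw [← neg_sub, neg_sq]
    exact this ht hs (le_of_not_ge hst)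
  calc (p.eval s - p.eval t) ^ 2 = (∫ x in s..t, (derivative p).eval x) ^ 2 := by
        rw [integral_derivative_eval]; ring
    _ ≤ (t - s) * ∫ x in s..t, (derivative p).eval x ^ 2 :=
        sq_intervalIntegral_le (derivative p).continuous hst
    _ ≤ (b - a) * ∫ x in a..b, (derivative p).eval x ^ 2 := by
        refine mul_le_mul (by linarith [hs.1, ht.2]) ?_ (intervalIntegral.integral_nonneg hst
          fun x _ => sq_nonneg _) (by linarith [hs.1, ht.2])
        exact intervalIntegral.integral_mono_interval hs.1 hst ht.2
          (Filter.Eventually.of_forall fun x => sq_nonneg _)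
          (((derivative p).continuous.pow 2).intervalIntegrable a b)

namespace IsIntervalFamily

variable {ι : Type*} {S : Finset ι} {a b : ι → ℝ} (hS : IsIntervalFamily S a b)
include hS

theorem erase [DecidableEq ι] (i : ι) : IsIntervalFamily (S.erase i) a b :=
  ⟨fun i₁ h => hS.lt i₁ (Finset.mem_of_mem_erase h), fun i₁ h i₂ h' =>
    hS.le_or_le i₁ (Finset.mem_of_mem_erase h) i₂ (Finset.mem_of_mem_erase h')⟩

theorem eq_of_left_eq {i i' : ι} (hi : i ∈ S) (hi' : i' ∈ S) (h : a i = a i') : i = i' := by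
  by_contra hne
  have h₁ := hS.lt i hi
  have h₂ := hS.lt i' hi'
  rcases hS.le_or_le i hi i' hi' hne with h' | h' <;> linarith

theorem eq_of_right_eq {i i' : ι} (hi : i ∈ S) (hi' : i' ∈ S) (h : b i = b i') : i = i' := by
  by_contra hne
  have h₁ := hS.lt i hi
  have h₂ := hS.lt i' hi'
  rcases hS.le_or_le i hi i' hi' hne with h' | h' <;> linarith

theorem sum_adjacent_add_sum_ends_le {ends : ι → Bool → Prop} [∀ i s, Decidable (ends i s)]
    {w : ι → ℝ} (hw : ∀ i ∈ S, 0 ≤ w i)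
    (hends : ∀ i ∈ S, ∀ i' ∈ S, b i = a i' → ¬ends i true ∧ ¬ends i' false) :
    (∑ i ∈ S, ∑ i' ∈ S, if b i = a i' then w i + w i' else 0)
      + (∑ i ∈ S, ∑ s, if ends i s then w i else 0) ≤ 2 * ∑ i ∈ S, w i := by
  have hright : ∀ i ∈ S, (∑ i' ∈ S, if b i = a i' then w i else 0)
      + (if ends i true then w i else 0) ≤ w i := fun i hi =>
    sum_ite_add_ite_le (hw i hi) (fun i₁ h₁ i₂ h₂ e₁ e₂ => hS.eq_of_left_eq h₁ h₂ (e₁ ▸ e₂))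
      fun i' hi' h => (hends i hi i' hi' h).1
  have hleft : ∀ i ∈ S, (∑ i' ∈ S, if b i' = a i then w i else 0)
      + (if ends i false then w i else 0) ≤ w i := fun i hi =>
    sum_ite_add_ite_le (hw i hi)
      (fun i₁ h₁ i₂ h₂ e₁ e₂ => hS.eq_of_right_eq h₁ h₂ (e₁.trans e₂.symm))
      fun i' hi' h => (hends i' hi' i hi h).2
  have hsplit : (∑ i ∈ S, ∑ i' ∈ S, if b i = a i' then w i + w i' else 0)
      = (∑ i ∈ S, ∑ i' ∈ S, if b i = a i' then w i else 0)
        + ∑ i ∈ S, ∑ i' ∈ S, if b i' = a i then w i else 0 := by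
    rw [Finset.sum_comm (f := fun i i' => if b i' = a i then w i else 0)]
    simp only [← Finset.sum_add_distrib]
    refine Finset.sum_congr rfl fun i _ => Finset.sum_congr rfl fun i' _ => ?_
    split_ifs <;> simp
  have h₁ := Finset.sum_le_sum hright
  have h₂ := Finset.sum_le_sum hleft
  simp only [Finset.sum_add_distrib, Fintype.sum_bool] at h₁ h₂ hsplit ⊢
  linarith

theorem sum_length_le_diam {U : Set ℝ} (hU : Bornology.IsBounded U)
    (hsub : ∀ i ∈ S, Ioo (a i) (b i) ⊆ U) : ∑ i ∈ S, (b i - a i) ≤ Metric.diam U := by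
  have hlen : ∀ i ∈ S, 0 ≤ b i - a i := fun i hi => (sub_pos.mpr (hS.lt i hi)).le
  have hunion : volume (⋃ i ∈ S, Ioo (a i) (b i)) = ∑ i ∈ S, volume (Ioo (a i) (b i)) := by
    refine measure_biUnion_finset (fun i hi i' hi' hne => ?_) fun i _ => measurableSet_Ioo
    refine disjoint_left.mpr fun x hx hx' => ?_
    rcases hS.le_or_le i hi i' hi' hne with h | h
    · exact absurd (hx.2.trans_le h) (not_lt.mpr hx'.1.le)
    · exact absurd (hx'.2.trans_le h) (not_lt.mpr hx.1.le)
  have hle : ENNReal.ofReal (∑ i ∈ S, (b i - a i)) ≤ Metric.ediam U := by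
    rw [ENNReal.ofReal_sum_of_nonneg hlen]
    simp only [← Real.volume_Ioo]
    rw [← hunion]
    exact (measure_mono (iUnion₂_subset hsub)).trans (Real.volume_le_diam U)
  exact (ENNReal.ofReal_le_iff_le_toReal hU.ediam_ne_top).mp hle

theorem exists_next [DecidableEq ι] {i i' : ι} {t : ℝ} (hi : i ∈ S) (hi' : i' ∈ S) (hne : i ≠ i')
    (hle : b i ≤ a i') (ht : t ∈ Icc (a i') (b i'))
    (hcov : ∀ x ∈ Ioo (b i) t, ∃ i₁ ∈ S.erase i, x ∈ Icc (a i₁) (b i₁)) :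
    ∃ i₁ ∈ S.erase i, a i₁ = b i ∧ (i₁ = i' ∨ b i₁ ≤ a i') := by
  rcases hle.eq_or_lt with heq | hlt
  · exact ⟨i', Finset.mem_erase.mpr ⟨hne.symm, hi'⟩, heq.symm, Or.inl rfl⟩
  have hleft : ∀ i₁ ∈ S.erase i, a i₁ < b i → b i₁ ≤ b i := fun i₁ hi₁ h => by
    have ⟨hne₁, hi₁⟩ := Finset.mem_erase.mp hi₁
    rcases hS.le_or_le i₁ hi₁ i hi hne₁ with h' | h'
    · exact h'.trans (hS.lt i hi).le
    · exact absurd h (not_lt.mpr h')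
  obtain ⟨i₁, hi₁, hstart⟩ := exists_left_endpoint_eq (hlt.trans_le ht.1) hleft hcov
  refine ⟨i₁, hi₁, hstart, or_iff_not_imp_left.mpr fun hne₁ => ?_⟩
  refine (hS.le_or_le i₁ (Finset.mem_of_mem_erase hi₁) i' hi' hne₁).resolve_right fun h => ?_
  linarith [hS.lt i' hi']

theorem abs_sub_le_sum_variation {p : ι → ℝ → ℝ} {D : ι → ℝ} {i i' : ι} {s t : ℝ}
    (hD : ∀ i ∈ S, ∀ s ∈ Icc (a i) (b i), ∀ t ∈ Icc (a i) (b i), |p i s - p i t| ≤ D i)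
    (hcov : ∀ x ∈ Ioo s t, ∃ i ∈ S, x ∈ Icc (a i) (b i)) (hi : i ∈ S) (hi' : i' ∈ S)
    (hs : s ∈ Icc (a i) (b i)) (ht : t ∈ Icc (a i') (b i')) (horder : i = i' ∨ b i ≤ a i') :
    |p i s - p i' t| ≤ ∑ i ∈ S, D i
      + ∑ i₁ ∈ S, ∑ i₂ ∈ S, if b i₁ = a i₂ then |p i₁ (b i₁) - p i₂ (b i₁)| else 0 := by
  classical
  -- Walk from `i` to the interval `i₁` that starts where `i` ends, and discard `i`.
  induction S using Finset.strongInduction generalizing i s with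
  | H S ih =>
    have hD₀ : ∀ i ∈ S, 0 ≤ D i := fun i hi => (abs_nonneg _).trans
      (hD i hi _ (left_mem_Icc.mpr (hS.lt i hi).le) _ (left_mem_Icc.mpr (hS.lt i hi).le))
    have hJ₀ : ∀ i₁ i₂, 0 ≤ if b i₁ = a i₂ then |p i₁ (b i₁) - p i₂ (b i₁)| else 0 :=
      fun i₁ i₂ => by split_ifs <;> positivity
    by_cases hne : i = i'
    · subst hne
      exact ((hD i hi s hs t ht).trans (Finset.single_le_sum hD₀ hi)).trans
        (le_add_of_nonneg_right (Finset.sum_nonneg fun i₁ _ => Finset.sum_nonneg fun i₂ _ =>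
          hJ₀ i₁ i₂))
    have hle : b i ≤ a i' := horder.resolve_left hne
    have hi'S : i' ∈ S.erase i := Finset.mem_erase.mpr ⟨Ne.symm hne, hi'⟩
    have hcov' : ∀ x ∈ Ioo (b i) t, ∃ i₁ ∈ S.erase i, x ∈ Icc (a i₁) (b i₁) := by
      intro x hx
      obtain ⟨i₁, hi₁, hx₁⟩ := hcov x ⟨hs.2.trans_lt hx.1, hx.2⟩
      refine ⟨i₁, Finset.mem_erase.mpr ⟨?_, hi₁⟩, hx₁⟩
      rintro rfl
      exact absurd hx.1 (not_lt.mpr hx₁.2)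
    obtain ⟨i₁, hi₁, hstart, horder₁⟩ := hS.exists_next hi hi' hne hle ht hcov'
    have hi₁S := Finset.mem_of_mem_erase hi₁
    have hrec := ih (S.erase i) (Finset.erase_ssubset hi) (hS.erase i)
      (fun i h => hD i (Finset.mem_of_mem_erase h)) hcov' hi₁ hi'S
      ⟨hstart.le, hstart ▸ (hS.lt i₁ hi₁S).le⟩ horder₁
    have hcells := Finset.add_sum_erase S D hi
    have hjumps := add_sum_sum_erase_le hJ₀ hi hi₁S
    rw [if_pos hstart.symm] at hjumps
    have hcell := hD i hi s hs (b i) (right_mem_Icc.mpr (hS.lt i hi).le)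
    have htri : |p i s - p i' t| ≤ |p i s - p i (b i)| + |p i (b i) - p i₁ (b i)|
        + |p i₁ (b i) - p i' t| :=
      (abs_sub_le _ (p i₁ (b i)) _).trans (add_le_add_left (abs_sub_le _ _ _) _)
    linarith

theorem sq_sum_jumps_le (p : ι → ℝ → ℝ) :
    (∑ i₁ ∈ S, ∑ i₂ ∈ S, if b i₁ = a i₂ then |p i₁ (b i₁) - p i₂ (b i₁)| else 0) ^ 2
      ≤ (∑ i ∈ S, (b i - a i)) * ∑ i₁ ∈ S, ∑ i₂ ∈ S, if b i₁ = a i₂ then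
          (p i₂ (b i₁) - p i₁ (b i₁)) ^ 2 / ((b i₁ - a i₁ + (b i₂ - a i₂)) / 2) else 0 := by
  have hlen : ∀ i ∈ S, 0 < b i - a i := fun i hi => sub_pos.mpr (hS.lt i hi)
  have hmean : ∑ i₁ ∈ S, ∑ i₂ ∈ S, (if b i₁ = a i₂ then (b i₁ - a i₁ + (b i₂ - a i₂)) / 2 else 0)
      ≤ ∑ i ∈ S, (b i - a i) := by
    have h := hS.sum_adjacent_add_sum_ends_le (ends := fun _ _ => False)
      (fun i hi => (hlen i hi).le) (by simp)
    simp only [if_false, Finset.sum_const_zero, add_zero] at h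
    have h' := div_le_div_of_nonneg_right h two_pos.le
    simp only [Finset.sum_div, ite_div, zero_div] at h'
    linarith
  refine le_trans ?_ (mul_le_mul_of_nonneg_right hmean (Finset.sum_nonneg fun i₁ h₁ =>
    Finset.sum_nonneg fun i₂ h₂ => ?_))
  · simp only [← Finset.sum_product']
    refine Finset.sum_sq_le_sum_mul_sum_of_sq_le_mul _ ?_ ?_ ?_ <;> rintro ⟨i₁, i₂⟩ h <;>
      obtain ⟨h₁, h₂⟩ := Finset.mem_product.mp h <;>
      have h₁ := hlen i₁ h₁ <;> have h₂ := hlen i₂ h₂ <;> dsimp only <;> split_ifs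
    any_goals positivity
    · rw [mul_div_cancel₀ _ (by positivity), sq_abs, sub_sq_comm]
    · simp
  · have h₁ := hlen i₁ h₁
    have h₂ := hlen i₂ h₂
    split_ifs <;> positivity

theorem sq_eval_sub_le {p : ι → ℝ[X]} {i i' : ι} {s t : ℝ}
    (hcov : ∀ x ∈ Ioo s t, ∃ i ∈ S, x ∈ Icc (a i) (b i)) (hi : i ∈ S) (hi' : i' ∈ S)
    (hs : s ∈ Icc (a i) (b i)) (ht : t ∈ Icc (a i') (b i')) (hst : s < t) :
    ((p i).eval s - (p i').eval t) ^ 2 ≤ 2 * (∑ i ∈ S, (b i - a i))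
      * (∑ i ∈ S, (∫ x in a i..b i, (derivative (p i)).eval x ^ 2)
        + ∑ i₁ ∈ S, ∑ i₂ ∈ S, if b i₁ = a i₂ then ((p i₂).eval (b i₁) - (p i₁).eval (b i₁)) ^ 2
            / ((b i₁ - a i₁ + (b i₂ - a i₂)) / 2) else 0) := by
  set L := ∑ i ∈ S, (b i - a i)
  set E := fun i => ∫ x in a i..b i, (derivative (p i)).eval x ^ 2
  have hlen : ∀ i ∈ S, 0 < b i - a i := fun i hi => sub_pos.mpr (hS.lt i hi)
  have hE : ∀ i ∈ S, 0 ≤ E i := fun i hi =>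
    intervalIntegral.integral_nonneg (hS.lt i hi).le fun x _ => sq_nonneg _
  have horder : i = i' ∨ b i ≤ a i' := or_iff_not_imp_left.mpr fun hne =>
    (hS.le_or_le i hi i' hi' hne).resolve_right fun h => by linarith [hs.1, ht.2]
  have hwalk := hS.abs_sub_le_sum_variation (p := fun i x => (p i).eval x)
    (D := fun i => √((b i - a i) * E i))
    (fun i _ s hs t ht => Real.abs_le_sqrt (DDG.sq_eval_sub_le (p i) hs ht)) hcov hi hi' hs ht
    horder
  have hcells : (∑ i ∈ S, √((b i - a i) * E i)) ^ 2 ≤ L * ∑ i ∈ S, E i :=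
    Finset.sum_sq_le_sum_mul_sum_of_sq_le_mul _ (fun i hi => (hlen i hi).le) hE
      fun i hi => (Real.sq_sqrt (mul_nonneg (hlen i hi).le (hE i hi))).le
  have hL₀ : 0 ≤ L := Finset.sum_nonneg fun i hi => (hlen i hi).le
  rw [← sq_abs, two_mul]
  refine (pow_le_pow_left₀ (abs_nonneg _) hwalk 2).trans
    (add_sq_le_of_sq_le_mul hL₀ hL₀ (Finset.sum_nonneg hE) ?_ hcells
      (hS.sq_sum_jumps_le fun i x => (p i).eval x))
  refine Finset.sum_nonneg fun i₁ h₁ => Finset.sum_nonneg fun i₂ h₂ => ?_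
  have h₁ := hlen i₁ h₁
  have h₂ := hlen i₂ h₂
  split_ifs <;> positivity

end IsIntervalFamily

/-! ### The threshold for the penalty parameter -/

/-- The number `β₀*`: besides twice the trace constant `Gam k 0` of Dirichlet faces, it dominates
the trace constants at interfaces of cells whose mean normal width is `t` times the width of one of
them, where a ratio bound `κ` restricts `t` to the displayed interval. -/
def threshold (k : ℕ) (β₁ κ : ℝ) : ℝ :=
  max 2 (max (sSup ((fun t => t * Gam k (t * β₁)) '' Icc ((1 + κ⁻¹) / 2) ((1 + κ) / 2)))
    (2 * Gam k 0))

theorem one_lt_threshold (k : ℕ) (β₁ κ : ℝ) : 1 < threshold k β₁ κ :=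
  one_lt_two.trans_le (le_max_left _ _)

theorem two_mul_Gam_zero_le_threshold (k : ℕ) (β₁ κ : ℝ) : 2 * Gam k 0 ≤ threshold k β₁ κ :=
  (le_max_right _ _).trans (le_max_right _ _)

theorem mul_Gam_le_threshold (k : ℕ) (β₁ : ℝ) {κ t : ℝ}
    (ht : t ∈ Icc ((1 + κ⁻¹) / 2) ((1 + κ) / 2)) : t * Gam k (t * β₁) ≤ threshold k β₁ κ := by
  have hcont : Continuous fun t : ℝ => t * Gam k (t * β₁) := by
    unfold Gam
    fun_prop
  exact (le_csSup (isCompact_Icc.bddAbove_image hcont.continuousOn)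
    (mem_image_of_mem _ ht)).trans ((le_max_left _ _).trans (le_max_right _ _))

theorem threshold_one {k : ℕ} (hk : 1 ≤ k) (β₁ : ℝ) :
    threshold k β₁ 1 = max (Gam k β₁) (2 * Gam k 0) := by
  have htwo : 2 ≤ max (Gam k β₁) (2 * Gam k 0) := by
    refine le_max_of_le_right ?_
    have : (1 : ℝ) ≤ k := by exact_mod_cast hk
    simp only [Gam]
    nlinarith
  norm_num [threshold, htwo]

theorem mean_div_mem_Icc {κ w₁ w₂ : ℝ} (h₁ : 0 < w₁) (h₂ : 0 < w₂) (hw₁ : w₁ ≤ κ * w₂)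
    (hw₂ : w₂ ≤ κ * w₁) : (w₁ + w₂) / 2 / w₁ ∈ Icc ((1 + κ⁻¹) / 2) ((1 + κ) / 2) := by
  have hκ : 0 < κ := pos_of_mul_pos_left (h₁.trans_le hw₁) h₂.le
  have hratio : (w₁ + w₂) / 2 / w₁ = (1 + w₂ / w₁) / 2 := by
    field_simp
  have hlower : κ⁻¹ ≤ w₂ / w₁ := by
    rwa [le_div_iff₀ h₁, inv_mul_le_iff₀ hκ]
  have hupper : w₂ / w₁ ≤ κ := (div_le_iff₀ h₁).mpr hw₂
  rw [hratio]
  exact ⟨by linarith, by linarith⟩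

theorem neg_add_le_two_mul {β h : ℝ} (hβ : 0 < β) (hh : 0 < h) (x y : ℝ) :
    -(β * (x ^ 2 / h) + h * y ^ 2 / β) ≤ 2 * (x * y) := by
  have hsq : β * (x ^ 2 / h) + h * y ^ 2 / β + 2 * (x * y) = β / h * (x + h * y / β) ^ 2 := by
    field_simp
    ring
  have hnonneg : 0 ≤ β / h * (x + h * y / β) ^ 2 := by positivity
  linarith

namespace RectMesh

variable {T : RectMesh Ω} {k : ℕ}

/-! ### Geometry of the cells met by a line -/

theorem width_pos (B : Box (Fin (n + 1))) (j : Fin (n + 1)) : 0 < width B j :=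
  sub_pos.mpr (B.lower_lt_upper j)

theorem hInterface_pos (T : RectMesh Ω) (K₁ K₂ : Fin T.numCells) (j : Fin (n + 1)) :
    0 < T.hInterface K₁ K₂ j :=
  half_pos (add_pos (width_pos _ _) (width_pos _ _))

theorem isOpen (T : RectMesh Ω) : IsOpen Ω :=
  (congrArg IsOpen T.interior_union).mpr isOpen_interior

theorem subset_iUnion_Icc_cell (T : RectMesh Ω) : Ω ⊆ ⋃ K, Box.Icc (T.cell K) :=
  T.interior_union.subset.trans interior_subset

theorem isBounded (T : RectMesh Ω) : Bornology.IsBounded Ω :=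
  (Bornology.isBounded_iUnion.mpr fun K => (T.cell K).isCompact_Icc.isBounded).subset
    T.subset_iUnion_Icc_cell

theorem Ioo_cell_subset (T : RectMesh Ω) (K : Fin T.numCells) : Box.Ioo (T.cell K) ⊆ Ω :=
  (interior_maximal ((Box.Ioo_subset_Icc _).trans (subset_iUnion
    (fun K => Box.Icc (T.cell K)) K)) (isOpen_boxIoo _)).trans T.interior_union.symm.subset

theorem isIntervalFamily_lineCells (T : RectMesh Ω) (j : Fin (n + 1)) (y : Fin n → ℝ) :
    IsIntervalFamily (T.lineCells j y) (fun K => (T.cell K).lower j)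
      (fun K => (T.cell K).upper j) where
  lt K _ := (T.cell K).lower_lt_upper j
  le_or_le K hK K' hK' hne := by
    by_contra! h
    obtain ⟨t, ht₁, ht₂⟩ := exists_between (max_lt (lt_min ((T.cell K).lower_lt_upper j) h.2)
      (lt_min h.1 ((T.cell K').lower_lt_upper j)))
    rw [max_lt_iff] at ht₁
    rw [lt_min_iff] at ht₂
    exact disjoint_left.mp (T.disjoint_cells K K' hne)
      (insertNth_mem_Ioo.mpr ⟨⟨ht₁.1, ht₂.1⟩, mem_lineCells.mp hK⟩)
      (insertNth_mem_Ioo.mpr ⟨⟨ht₁.2, ht₂.2⟩, mem_lineCells.mp hK'⟩)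

theorem insertNth_upper_mem (T : RectMesh Ω) {j : Fin (n + 1)} {y : Fin n → ℝ}
    {K₁ K₂ : Fin T.numCells} (h : (T.cell K₁).upper j = (T.cell K₂).lower j)
    (h₁ : K₁ ∈ T.lineCells j y) (h₂ : K₂ ∈ T.lineCells j y) :
    (j.insertNth ((T.cell K₁).upper j) y : Fin (n + 1) → ℝ) ∈ Ω := by
  let U : Set (Fin (n + 1) → ℝ) := {x | x j ∈ Ioo ((T.cell K₁).lower j) ((T.cell K₂).upper j) ∧
    j.removeNth x ∈ Box.Ioo ((T.cell K₁).face j) ∩ Box.Ioo ((T.cell K₂).face j)}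
  have hopen : IsOpen U :=
    (isOpen_Ioo.preimage (continuous_apply j)).inter
      (((isOpen_boxIoo _).inter (isOpen_boxIoo _)).preimage
        (continuous_pi fun i => continuous_apply (j.succAbove i)))
  have hsub : U ⊆ ⋃ K, Box.Icc (T.cell K) := by
    rintro x ⟨hx, hx₁, hx₂⟩
    rw [← Fin.insertNth_self_removeNth j x, mem_iUnion]
    rcases le_total (x j) ((T.cell K₁).upper j) with hle | hle
    · exact ⟨K₁, insertNth_mem_Icc.mpr ⟨⟨hx.1.le, hle⟩, Box.Ioo_subset_Icc _ hx₁⟩⟩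
    · exact ⟨K₂, insertNth_mem_Icc.mpr ⟨⟨h ▸ hle, hx.2.le⟩, Box.Ioo_subset_Icc _ hx₂⟩⟩
  refine T.interior_union.symm.subset (interior_maximal hsub hopen ⟨?_, ?_⟩)
  · simp only [Fin.insertNth_apply_same]
    exact ⟨(T.cell K₁).lower_lt_upper j, h ▸ (T.cell K₂).lower_lt_upper j⟩
  · simpa using ⟨mem_lineCells.mp h₁, mem_lineCells.mp h₂⟩

/-! ### Coercivity with respect to the energy -/

@[fun_prop]
theorem continuous_jump (v : T.Space k) (K₁ K₂ : Fin T.numCells) : Continuous (jump v K₁ K₂) := by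
  unfold jump
  fun_prop

@[fun_prop]
theorem continuous_avgD1 (v : T.Space k) (K₁ K₂ : Fin T.numCells) (j : Fin (n + 1)) :
    Continuous (avgD1 v K₁ K₂ j) := by
  unfold avgD1
  fun_prop

@[fun_prop]
theorem continuous_flux (β₀ β₁ : ℝ) (v : T.Space k) (K₁ K₂ : Fin T.numCells) (j : Fin (n + 1)) :
    Continuous (flux β₀ β₁ v K₁ K₂ j) := by
  unfold flux jumpD2
  fun_prop

/-- The integrands of the squared energy norm: broken gradient, scaled jumps and scaled Dirichlet
trace. -/
def energyIntegrand (v : T.Space k) : MeshIntegrand T where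
  cell K j x := d1 v K j x ^ 2
  interface K₁ K₂ j x := jump v K₁ K₂ x ^ 2 / T.hInterface K₁ K₂ j
  boundary K j _ x := val v K x ^ 2 / width (T.cell K) j
  continuous_cell K j := by fun_prop
  continuous_interface K₁ K₂ j := by fun_prop
  continuous_boundary K j _ := by fun_prop

/-- The integrands of `formA`. -/
def formIntegrand (β₀ β₁ : ℝ) (ψ η : T.Space k) : MeshIntegrand T where
  cell K j x := d1 ψ K j x * d1 η K j x
  interface K₁ K₂ j x :=
    flux β₀ β₁ ψ K₁ K₂ j x * jump η K₁ K₂ x + avgD1 η K₁ K₂ j x * jump ψ K₁ K₂ x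
  boundary K j s x := (β₀ / width (T.cell K) j * val ψ K x - normalSign s * d1 ψ K j x) * val η K x
    - val ψ K x * (normalSign s * d1 η K j x)
  continuous_cell K j := by fun_prop
  continuous_interface K₁ K₂ j := by fun_prop
  continuous_boundary K j s := by fun_prop

/-- The squared energy norm of `v`. -/
def energy (Γ : Set (Fin (n + 1) → ℝ)) (v : T.Space k) : ℝ := (energyIntegrand v).meshSum Γ

/-- The contribution to the energy of `v` of the line in direction `j` through `y`. -/
def lineEnergy (Γ : Set (Fin (n + 1) → ℝ)) (v : T.Space k) (j : Fin (n + 1)) (y : Fin n → ℝ) : ℝ :=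
  (energyIntegrand v).lineSum Γ j y

/-- The Dirichlet energy of `v` on the segment in which a line meets the cell `K`. -/
def segmentEnergy (v : T.Space k) (K : Fin T.numCells) (j : Fin (n + 1)) (y : Fin n → ℝ) : ℝ :=
  ∫ t in (T.cell K).lower j..(T.cell K).upper j, (derivative (line v K j y)).eval t ^ 2

theorem formA_eq_meshSum (Γ : Set (Fin (n + 1) → ℝ)) (β₀ β₁ : ℝ) (ψ η : T.Space k) :
    formA Γ β₀ β₁ ψ η = (formIntegrand β₀ β₁ ψ η).meshSum Γ := rfl

theorem segmentEnergy_nonneg (v : T.Space k) (K : Fin T.numCells) (j : Fin (n + 1))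
    (y : Fin n → ℝ) : 0 ≤ segmentEnergy v K j y :=
  intervalIntegral.integral_nonneg ((T.cell K).lower_lt_upper j).le fun _ _ => sq_nonneg _

theorem lineCellSum_energyIntegrand (v : T.Space k) (j : Fin (n + 1)) (y : Fin n → ℝ) :
    (energyIntegrand v).lineCellSum j y = ∑ K ∈ T.lineCells j y, segmentEnergy v K j y := by
  simp only [MeshIntegrand.lineCellSum, energyIntegrand, d1_insertNth, segmentEnergy]

theorem lineCellSum_formIntegrand (β₀ β₁ : ℝ) (v : T.Space k) (j : Fin (n + 1)) (y : Fin n → ℝ) :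
    (formIntegrand β₀ β₁ v v).lineCellSum j y = ∑ K ∈ T.lineCells j y, segmentEnergy v K j y := by
  simp only [MeshIntegrand.lineCellSum, formIntegrand, d1_insertNth, segmentEnergy, sq]

theorem width_mul_sq_trace_le (v : T.Space k) (K : Fin T.numCells) (j : Fin (n + 1)) (s : Bool)
    (y : Fin n → ℝ) (c : ℝ) :
    width (T.cell K) j * (d1 v K j (facePoint (T.cell K) j s y)
        - normalSign s * (c * (width (T.cell K) j * d2 v K j (facePoint (T.cell K) j s y)))) ^ 2
      ≤ Gam k c * segmentEnergy v K j y := by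
  have hp : (derivative (line v K j y)).degree < k := degree_derivative_linePoly_lt j y (v K)
  have hab := (T.cell K).lower_lt_upper j
  cases s
  · simpa [facePoint, faceCoord, d1_insertNth, d2_insertNth, normalSign, width, segmentEnergy] using
      width_mul_sq_left_le hp c hab
  · simpa [facePoint, faceCoord, d1_insertNth, d2_insertNth, normalSign, width, segmentEnergy] using
      width_mul_sq_right_le hp c hab

theorem mul_sq_trace_le_threshold {β₁ κ h : ℝ} (v : T.Space k) (K : Fin T.numCells)
    (j : Fin (n + 1)) (s : Bool) (y : Fin n → ℝ)
    (hκ : h / width (T.cell K) j ∈ Icc ((1 + κ⁻¹) / 2) ((1 + κ) / 2)) (hh : 0 ≤ h) :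
    h * (d1 v K j (facePoint (T.cell K) j s y)
        - normalSign s * (β₁ * h * d2 v K j (facePoint (T.cell K) j s y))) ^ 2
      ≤ threshold k β₁ κ * segmentEnergy v K j y := by
  have hw := width_pos (T.cell K) j
  set w := width (T.cell K) j
  set P := d1 v K j (facePoint (T.cell K) j s y)
  set Q := d2 v K j (facePoint (T.cell K) j s y)
  calc h * (P - normalSign s * (β₁ * h * Q)) ^ 2
      = h / w * (w * (P - normalSign s * (h / w * β₁ * (w * Q))) ^ 2) := by
        field_simp
    _ ≤ h / w * (Gam k (h / w * β₁) * segmentEnergy v K j y) :=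
        mul_le_mul_of_nonneg_left (width_mul_sq_trace_le v K j s y _) (div_nonneg hh hw.le)
    _ = h / w * Gam k (h / w * β₁) * segmentEnergy v K j y := by ring
    _ ≤ threshold k β₁ κ * segmentEnergy v K j y :=
        mul_le_mul_of_nonneg_right (mul_Gam_le_threshold k β₁ hκ) (segmentEnergy_nonneg v K j y)

theorem interface_formIntegrand_ge {β₀ β₁ κ β' : ℝ} (hT : T.RatioBound κ) (hβ' : 0 < β')
    (v : T.Space k) {j : Fin (n + 1)} {y : Fin n → ℝ} {K₁ K₂ : Fin T.numCells}
    (hadj : Adjacent (T.cell K₁) (T.cell K₂) j) :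
    (β₀ - β') * (energyIntegrand v).interface K₁ K₂ j (facePoint (T.cell K₁) j true y)
      - threshold k β₁ κ / β' / 2 * (segmentEnergy v K₁ j y + segmentEnergy v K₂ j y)
      ≤ (formIntegrand β₀ β₁ v v).interface K₁ K₂ j (facePoint (T.cell K₁) j true y) := by
  have hpoint : facePoint (T.cell K₁) j true y = facePoint (T.cell K₂) j false y := by
    simp [facePoint, faceCoord, hadj.1]
  have hw := hT K₁ K₂ j hadj
  have hw₁ := width_pos (T.cell K₁) j
  have hw₂ := width_pos (T.cell K₂) j
  have hh := hInterface_pos T K₁ K₂ j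
  have htrace₁ := mul_sq_trace_le_threshold (β₁ := β₁) (κ := κ) (h := T.hInterface K₁ K₂ j) v K₁ j
    true y (mean_div_mem_Icc hw₁ hw₂ hw.1 hw.2) hh.le
  have htrace₂ := mul_sq_trace_le_threshold (β₁ := β₁) (κ := κ) (h := T.hInterface K₁ K₂ j) v K₂ j
    false y (by
      rw [hInterface, add_comm (width (T.cell K₁) j)]
      exact mean_div_mem_Icc hw₂ hw₁ hw.2 hw.1) hh.le
  rw [← hpoint] at htrace₂
  simp only [energyIntegrand, formIntegrand, flux, avgD1, jumpD2]
  set h := T.hInterface K₁ K₂ j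
  set x := facePoint (T.cell K₁) j true y
  set J := jump v K₁ K₂ x
  -- The one-sided traces of `∂_n v + β₁ h [∂_n² v]`, so that twice the flux pairs `J` with `P + Q`.
  set P := d1 v K₁ j x - normalSign true * (β₁ * h * d2 v K₁ j x) with hP
  set Q := d1 v K₂ j x - normalSign false * (β₁ * h * d2 v K₂ j x) with hQ
  have hyoung := neg_add_le_two_mul hβ' hh J ((P + Q) / 2)
  have hmean : h * ((P + Q) / 2) ^ 2 / β'
      ≤ threshold k β₁ κ / β' / 2 * (segmentEnergy v K₁ j y + segmentEnergy v K₂ j y) := by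
    rw [div_div, mul_comm β', ← div_div, div_mul_eq_mul_div]
    refine div_le_div_of_nonneg_right ?_ hβ'.le
    nlinarith [mul_nonneg hh.le (sq_nonneg (P - Q))]
  have hform : (β₀ * J / h + (d1 v K₁ j x + d1 v K₂ j x) / 2 + β₁ * h * (d2 v K₂ j x - d2 v K₁ j x))
      * J + (d1 v K₁ j x + d1 v K₂ j x) / 2 * J
      = β₀ * (J ^ 2 / h) + 2 * (J * ((P + Q) / 2)) := by
    simp only [hP, hQ, normalSign, if_true, Bool.false_eq_true, if_false]
    ring
  rw [hform]
  linarith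

theorem boundary_formIntegrand_ge {β₀ β₁ β' : ℝ} (κ : ℝ) (hβ' : 0 < β') (v : T.Space k)
    (K : Fin T.numCells) (j : Fin (n + 1)) (s : Bool) (y : Fin n → ℝ) :
    (β₀ - β') * (energyIntegrand v).boundary K j s (facePoint (T.cell K) j s y)
      - threshold k β₁ κ / β' / 2 * segmentEnergy v K j y
      ≤ (formIntegrand β₀ β₁ v v).boundary K j s (facePoint (T.cell K) j s y) := by
  have hw := width_pos (T.cell K) j
  have htrace := width_mul_sq_trace_le v K j s y 0
  have hthreshold := mul_le_mul_of_nonneg_right (two_mul_Gam_zero_le_threshold k β₁ κ)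
    (segmentEnergy_nonneg v K j y)
  simp only [energyIntegrand, formIntegrand]
  set w := width (T.cell K) j
  set x := facePoint (T.cell K) j s y
  set N := normalSign s * d1 v K j x with hN
  have hNsq : N ^ 2 = d1 v K j x ^ 2 := by
    cases s <;> simp [hN, normalSign]
  have hyoung := neg_add_le_two_mul hβ' hw (val v K x) (-N)
  have hnormal : w * (-N) ^ 2 / β' ≤ threshold k β₁ κ / β' / 2 * segmentEnergy v K j y := by
    rw [div_div, mul_comm β', ← div_div, div_mul_eq_mul_div, neg_sq, hNsq]
    refine div_le_div_of_nonneg_right ?_ hβ'.le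
    simp only [zero_mul, mul_zero, sub_zero] at htrace
    linarith
  have hform : (β₀ / w * val v K x - N) * val v K x - val v K x * N
      = β₀ * (val v K x ^ 2 / w) + 2 * (val v K x * -N) := by ring
  rw [hform]
  linarith

open Classical in
theorem sum_adjacent_segmentEnergy_le {Γ : Set (Fin (n + 1) → ℝ)} (hΓ : Disjoint Γ Ω)
    (v : T.Space k) (j : Fin (n + 1)) (y : Fin n → ℝ) :
    (∑ K₁ ∈ T.lineCells j y, ∑ K₂ ∈ T.lineCells j y,
        if (T.cell K₁).upper j = (T.cell K₂).lower j then
          segmentEnergy v K₁ j y + segmentEnergy v K₂ j y else 0)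
      + (∑ K ∈ T.lineCells j y, ∑ s,
        if facePoint (T.cell K) j s y ∈ Γ then segmentEnergy v K j y else 0)
      ≤ 2 * ∑ K ∈ T.lineCells j y, segmentEnergy v K j y := by
  refine (T.isIntervalFamily_lineCells j y).sum_adjacent_add_sum_ends_le
    (ends := fun K s => facePoint (T.cell K) j s y ∈ Γ)
    (fun K _ => segmentEnergy_nonneg v K j y) fun K₁ h₁ K₂ h₂ h => ?_
  have hmem : facePoint (T.cell K₁) j true y ∈ Ω := T.insertNth_upper_mem h h₁ h₂
  have hpoint : facePoint (T.cell K₂) j false y = facePoint (T.cell K₁) j true y := by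
    simp [facePoint, faceCoord, h]
  exact ⟨fun hx => disjoint_left.mp hΓ hx hmem,
    fun hx => disjoint_left.mp hΓ hx (hpoint ▸ hmem)⟩

theorem lineSum_formIntegrand_ge {β₀ β₁ κ β' : ℝ} {Γ : Set (Fin (n + 1) → ℝ)} (hΓ : Disjoint Γ Ω)
    (hT : T.RatioBound κ) (hβ' : 0 < β') (v : T.Space k) (j : Fin (n + 1)) (y : Fin n → ℝ) :
    (1 - threshold k β₁ κ / β') * (energyIntegrand v).lineCellSum j y
      + (β₀ - β') * ((energyIntegrand v).lineInterfaceSum j y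
        + (energyIntegrand v).lineBoundarySum Γ j y)
      ≤ (formIntegrand β₀ β₁ v v).lineSum Γ j y := by
  classical
  set θ := threshold k β₁ κ / β' / 2 with hθ
  set S := T.lineCells j y
  have hθ₀ : 0 ≤ θ := by
    have := one_lt_threshold k β₁ κ
    positivity
  have hinterface := Finset.sum_le_sum fun K₁ (h₁ : K₁ ∈ S) =>
    Finset.sum_le_sum fun K₂ (h₂ : K₂ ∈ S) =>
      show (β₀ - β') * (if (T.cell K₁).upper j = (T.cell K₂).lower j then
            (energyIntegrand v).interface K₁ K₂ j (facePoint (T.cell K₁) j true y) else 0)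
          - θ * (if (T.cell K₁).upper j = (T.cell K₂).lower j then
            segmentEnergy v K₁ j y + segmentEnergy v K₂ j y else 0)
        ≤ if (T.cell K₁).upper j = (T.cell K₂).lower j then
            (formIntegrand β₀ β₁ v v).interface K₁ K₂ j (facePoint (T.cell K₁) j true y) else 0 by
      split_ifs with h
      · exact interface_formIntegrand_ge hT hβ' v
          ⟨h, y, mem_lineCells.mp h₁, mem_lineCells.mp h₂⟩
      · simp
  have hboundary := Finset.sum_le_sum fun K (_ : K ∈ S) =>
    Finset.sum_le_sum fun s (_ : s ∈ Finset.univ) =>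
      show (β₀ - β') * Γ.indicator ((energyIntegrand v).boundary K j s) (facePoint (T.cell K) j s y)
          - θ * (if facePoint (T.cell K) j s y ∈ Γ then segmentEnergy v K j y else 0)
        ≤ Γ.indicator ((formIntegrand β₀ β₁ v v).boundary K j s) (facePoint (T.cell K) j s y) by
      simp only [indicator_apply]
      split_ifs
      · exact boundary_formIntegrand_ge κ hβ' v K j s y
      · simp
  have hcount := mul_le_mul_of_nonneg_left (sum_adjacent_segmentEnergy_le hΓ v j y) hθ₀
  simp only [Finset.sum_sub_distrib, ← Finset.mul_sum] at hinterface hboundary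
  rw [MeshIntegrand.lineSum, lineCellSum_energyIntegrand, lineCellSum_formIntegrand]
  simp only [MeshIntegrand.lineInterfaceSum, MeshIntegrand.lineBoundarySum]
  have hhalf : threshold k β₁ κ / β' = 2 * θ := by rw [hθ]; ring
  rw [hhalf]
  linarith

theorem lineInterfaceSum_energyIntegrand_nonneg (v : T.Space k) (j : Fin (n + 1))
    (y : Fin n → ℝ) : 0 ≤ (energyIntegrand v).lineInterfaceSum j y := by
  refine Finset.sum_nonneg fun K₁ _ => Finset.sum_nonneg fun K₂ _ => ?_
  split_ifs
  · exact div_nonneg (sq_nonneg _) (hInterface_pos T K₁ K₂ j).le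
  · exact le_rfl

theorem indicator_boundary_energyIntegrand_nonneg (Γ : Set (Fin (n + 1) → ℝ)) (v : T.Space k)
    (K : Fin T.numCells) (j : Fin (n + 1)) (s : Bool) (x : Fin (n + 1) → ℝ) :
    0 ≤ Γ.indicator ((energyIntegrand v).boundary K j s) x :=
  indicator_nonneg (fun _ _ => div_nonneg (sq_nonneg _) (width_pos _ j).le) x

theorem lineBoundarySum_energyIntegrand_nonneg (Γ : Set (Fin (n + 1) → ℝ)) (v : T.Space k)
    (j : Fin (n + 1)) (y : Fin n → ℝ) : 0 ≤ (energyIntegrand v).lineBoundarySum Γ j y :=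
  Finset.sum_nonneg fun K _ => Finset.sum_nonneg fun s _ =>
    indicator_boundary_energyIntegrand_nonneg Γ v K j s _

theorem lineCellSum_energyIntegrand_nonneg (v : T.Space k) (j : Fin (n + 1)) (y : Fin n → ℝ) :
    0 ≤ (energyIntegrand v).lineCellSum j y := by
  rw [lineCellSum_energyIntegrand]
  exact Finset.sum_nonneg fun K _ => segmentEnergy_nonneg v K j y

theorem lineEnergy_nonneg (Γ : Set (Fin (n + 1) → ℝ)) (v : T.Space k) (j : Fin (n + 1))
    (y : Fin n → ℝ) : 0 ≤ lineEnergy Γ v j y :=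
  add_nonneg (add_nonneg (lineCellSum_energyIntegrand_nonneg v j y)
    (lineInterfaceSum_energyIntegrand_nonneg v j y))
    (lineBoundarySum_energyIntegrand_nonneg Γ v j y)

theorem min_mul_energy_le_formA {β₀ β₁ κ β' : ℝ} {Γ : Set (Fin (n + 1) → ℝ)}
    (hΓ : MeasurableSet Γ) (hdisj : Disjoint Γ Ω) (hT : T.RatioBound κ) (hβ' : 0 < β')
    (v : T.Space k) :
    min (1 - threshold k β₁ κ / β') (β₀ - β') * energy Γ v ≤ formA Γ β₀ β₁ v v := by
  rw [energy, MeshIntegrand.meshSum_eq_sum_integral_lineSum _ hΓ, formA_eq_meshSum,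
    MeshIntegrand.meshSum_eq_sum_integral_lineSum _ hΓ, Finset.mul_sum]
  refine Finset.sum_le_sum fun j _ => ?_
  rw [← integral_const_mul]
  refine integral_mono ((MeshIntegrand.integrable_lineSum _ j hΓ).const_mul _)
    (MeshIntegrand.integrable_lineSum _ j hΓ) fun y => ?_
  refine le_trans ?_ (lineSum_formIntegrand_ge hdisj hT hβ' v j y)
  dsimp only
  rw [MeshIntegrand.lineSum, add_assoc, mul_add]
  exact add_le_add
    (mul_le_mul_of_nonneg_right (min_le_left _ _) (lineCellSum_energyIntegrand_nonneg v j y))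
    (mul_le_mul_of_nonneg_right (min_le_right _ _)
      (add_nonneg (lineInterfaceSum_energyIntegrand_nonneg v j y)
        (lineBoundarySum_energyIntegrand_nonneg Γ v j y)))

end RectMesh

/-! ### Variation along a line -/

namespace RectMesh

variable {T : RectMesh Ω} {k : ℕ}

/-- The square of the piecewise polynomial `v`, set to zero outside the open cells. -/
def sqDensity (v : T.Space k) (x : Fin (n + 1) → ℝ) : ℝ :=
  ∑ K, (Box.Ioo (T.cell K)).indicator (fun x => val v K x ^ 2) x

theorem sqDensity_nonneg (v : T.Space k) (x : Fin (n + 1) → ℝ) : 0 ≤ sqDensity v x :=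
  Finset.sum_nonneg fun _ _ => indicator_nonneg (fun _ _ => sq_nonneg _) _

theorem sqDensity_eq_of_mem (v : T.Space k) {K : Fin T.numCells} {x : Fin (n + 1) → ℝ}
    (hx : x ∈ Box.Ioo (T.cell K)) : sqDensity v x = val v K x ^ 2 := by
  rw [sqDensity, Finset.sum_eq_single K, indicator_of_mem hx]
  · exact fun K' _ hne => indicator_of_notMem
      (fun h => disjoint_left.mp (T.disjoint_cells K' K hne) h hx) _
  · simp

theorem integrable_indicator_sq (v : T.Space k) (K : Fin T.numCells) :
    Integrable ((Box.Ioo (T.cell K)).indicator fun x => val v K x ^ 2) :=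
  (integrable_indicator_iff (isOpen_boxIoo _).measurableSet).mpr
    ((integrableOn_boxIcc _ (by fun_prop)).mono_set (Box.Ioo_subset_Icc _))

theorem integrable_sqDensity (v : T.Space k) : Integrable (sqDensity v) :=
  integrable_finsetSum _ fun K _ => integrable_indicator_sq v K

theorem l2norm_sq (v : T.Space k) :
    l2norm v ^ 2 = ∑ K, ∫ x in Box.Icc (T.cell K), val v K x ^ 2 :=
  Real.sq_sqrt (Finset.sum_nonneg fun _ _ => integral_nonneg fun _ => sq_nonneg _)

theorem l2norm_sq_eq_integral_sqDensity (v : T.Space k) :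
    l2norm v ^ 2 = ∫ x, sqDensity v x := by
  simp only [l2norm_sq, sqDensity]
  rw [integral_finsetSum _ fun K _ => integrable_indicator_sq v K]
  refine Finset.sum_congr rfl fun K _ => ?_
  rw [integral_indicator (isOpen_boxIoo _).measurableSet]
  exact (setIntegral_congr_set (Box.Ioo_ae_eq_Icc _)).symm

theorem ae_integrable_sqDensity_insertNth (v : T.Space k) (j : Fin (n + 1)) :
    ∀ᵐ y : Fin n → ℝ, Integrable fun t => sqDensity v (j.insertNth t y) := by
  have hInt := integrable_insertNth (j := j) (A := univ) (s := univ) (u := univ) (by simp)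
    (integrable_sqDensity v).integrableOn
  simp only [Measure.restrict_univ] at hInt
  exact hInt.prod_left_ae

/-- The line in direction `j` through `y` meets no cell in a lateral face. -/
def Generic (T : RectMesh Ω) (j : Fin (n + 1)) (y : Fin n → ℝ) : Prop :=
  ∀ K, y ∈ Box.Icc ((T.cell K).face j) → y ∈ Box.Ioo ((T.cell K).face j)

theorem ae_generic (T : RectMesh Ω) (j : Fin (n + 1)) : ∀ᵐ y, T.Generic j y := by
  simp only [Generic, ae_all_iff]
  intro K
  filter_upwards [(Box.Ioo_ae_eq_Icc ((T.cell K).face j)).mem_iff] with y hy using hy.mpr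

section LineVariation

variable {j : Fin (n + 1)} {y : Fin n → ℝ}

theorem Generic.exists_mem_lineCells (hy : T.Generic j y) {t : ℝ}
    (ht : (j.insertNth t y : Fin (n + 1) → ℝ) ∈ Ω) :
    ∃ K ∈ T.lineCells j y, t ∈ Icc ((T.cell K).lower j) ((T.cell K).upper j) := by
  obtain ⟨K, hK⟩ := mem_iUnion.mp (T.subset_iUnion_Icc_cell ht)
  obtain ⟨htK, hyK⟩ := insertNth_mem_Icc.mp hK
  exact ⟨K, mem_lineCells.mpr (hy K hyK), htK⟩

theorem Generic.ae_exists_mem_lineCells (hy : T.Generic j y) :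
    ∀ᵐ t : ℝ, (j.insertNth t y : Fin (n + 1) → ℝ) ∈ Ω →
      ∃ K ∈ T.lineCells j y, t ∈ Ioo ((T.cell K).lower j) ((T.cell K).upper j) := by
  have hne : ∀ᵐ t : ℝ, ∀ K, t ≠ (T.cell K).lower j ∧ t ≠ (T.cell K).upper j :=
    ae_all_iff.mpr fun K => (Measure.ae_ne volume _).and (Measure.ae_ne volume _)
  filter_upwards [hne] with t htne ht
  obtain ⟨K, hK, htK⟩ := hy.exists_mem_lineCells ht
  exact ⟨K, hK, htK.1.lt_of_ne' (htne K).1, htK.2.lt_of_ne (htne K).2⟩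

theorem sqDensity_insertNth (v : T.Space k) {K : Fin T.numCells} (hK : K ∈ T.lineCells j y) {t : ℝ}
    (ht : t ∈ Ioo ((T.cell K).lower j) ((T.cell K).upper j)) :
    sqDensity v (j.insertNth t y) = (line v K j y).eval t ^ 2 := by
  rw [sqDensity_eq_of_mem v (insertNth_mem_Ioo.mpr ⟨ht, mem_lineCells.mp hK⟩), val_insertNth]

theorem sum_width_lineCells_le (T : RectMesh Ω) (j : Fin (n + 1)) (y : Fin n → ℝ) :
    ∑ K ∈ T.lineCells j y, width (T.cell K) j ≤ Metric.diam Ω := by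
  have hproj : LipschitzWith 1 fun x : Fin (n + 1) → ℝ => x j := LipschitzWith.eval j
  refine ((T.isIntervalFamily_lineCells j y).sum_length_le_diam
    (hproj.isBounded_image T.isBounded) fun K hK t ht => ?_).trans
    ((hproj.diam_image_le Ω T.isBounded).trans_eq (one_mul _))
  exact ⟨_, T.Ioo_cell_subset K (insertNth_mem_Ioo.mpr ⟨ht, mem_lineCells.mp hK⟩),
    Fin.insertNth_apply_same ..⟩

theorem width_le_diam {K : Fin T.numCells} (hK : K ∈ T.lineCells j y) :
    width (T.cell K) j ≤ Metric.diam Ω :=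
  (Finset.single_le_sum (fun K _ => (width_pos (T.cell K) j).le) hK).trans
    (T.sum_width_lineCells_le j y)

variable (Γ : Set (Fin (n + 1) → ℝ)) (v : T.Space k)

theorem lineCellSum_add_lineInterfaceSum_le_lineEnergy :
    (energyIntegrand v).lineCellSum j y + (energyIntegrand v).lineInterfaceSum j y
      ≤ lineEnergy Γ v j y :=
  le_add_of_nonneg_right (lineBoundarySum_energyIntegrand_nonneg Γ v j y)

theorem Generic.sq_line_sub_le (hy : T.Generic j y) {K K' : Fin T.numCells}
    (hK : K ∈ T.lineCells j y) (hK' : K' ∈ T.lineCells j y) {s t : ℝ}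
    (hs : s ∈ Icc ((T.cell K).lower j) ((T.cell K).upper j))
    (ht : t ∈ Icc ((T.cell K').lower j) ((T.cell K').upper j)) (hst : s ≠ t)
    (hmem : ∀ x ∈ uIoo s t, (j.insertNth x y : Fin (n + 1) → ℝ) ∈ Ω) :
    ((line v K j y).eval s - (line v K' j y).eval t) ^ 2
      ≤ 2 * Metric.diam Ω * lineEnergy Γ v j y := by
  wlog hlt : s < t generalizing K K' s t
  · rw [sub_sq_comm]
    exact this hK' hK ht hs hst.symm (by rwa [uIoo_comm]) (hst.symm.lt_of_le (not_lt.mp hlt))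
  rw [uIoo_of_lt hlt] at hmem
  refine ((T.isIntervalFamily_lineCells j y).sq_eval_sub_le (p := fun K => line v K j y)
    (fun x hx => hy.exists_mem_lineCells (hmem x hx)) hK hK' hs ht hlt).trans ?_
  have henergy := lineCellSum_add_lineInterfaceSum_le_lineEnergy (j := j) (y := y) Γ v
  have hnonneg := add_nonneg (lineCellSum_energyIntegrand_nonneg v j y)
    (lineInterfaceSum_energyIntegrand_nonneg v j y)
  rw [lineCellSum_energyIntegrand] at henergy hnonneg
  simp only [MeshIntegrand.lineInterfaceSum, energyIntegrand, jump, facePoint, faceCoord, if_true,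
    val_insertNth, segmentEnergy] at henergy hnonneg
  exact mul_le_mul (mul_le_mul_of_nonneg_left (T.sum_width_lineCells_le j y) two_pos.le) henergy
    hnonneg (by positivity)

theorem sq_le_two_mul_add {a b c : ℝ} (h : (a - b) ^ 2 ≤ c) : a ^ 2 ≤ 2 * b ^ 2 + 2 * c := by
  linarith [sq_nonneg (a - 2 * b)]

theorem Generic.ae_sqDensity_le (hy : T.Generic j y) {α β : ℝ}
    (hmem : ∀ x ∈ Ioo α β, (j.insertNth x y : Fin (n + 1) → ℝ) ∈ Ω) :
    ∀ᵐ s : ℝ, ∀ᵐ t : ℝ, s ∈ Ioo α β → t ∈ Ioo α β → sqDensity v (j.insertNth s y)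
      ≤ 2 * sqDensity v (j.insertNth t y) + 4 * Metric.diam Ω * lineEnergy Γ v j y := by
  filter_upwards [hy.ae_exists_mem_lineCells] with s hs
  filter_upwards [hy.ae_exists_mem_lineCells, Measure.ae_ne volume s] with t ht hne hsαβ htαβ
  obtain ⟨K, hK, hsK⟩ := hs (hmem s hsαβ)
  obtain ⟨K', hK', htK'⟩ := ht (hmem t htαβ)
  have hdiff := hy.sq_line_sub_le Γ v hK hK' (Ioo_subset_Icc_self hsK) (Ioo_subset_Icc_self htK')
    hne.symm fun x hx =>
      hmem x (uIoo_subset_Ioo (Ioo_subset_Icc_self hsαβ) (Ioo_subset_Icc_self htαβ) hx)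
  rw [sqDensity_insertNth v hK hsK, sqDensity_insertNth v hK' htK']
  linarith [sq_le_two_mul_add hdiff]

variable {Γ} {B : Box (Fin (n + 1))} {s : Bool}

theorem Generic.exists_faceCoord_eq (hy : T.Generic j y)
    (hmem : ∀ x ∈ Ioo (B.lower j) (B.upper j), (j.insertNth x y : Fin (n + 1) → ℝ) ∈ Ω)
    (hface : facePoint B j s y ∉ Ω) :
    ∃ K ∈ T.lineCells j y, faceCoord (T.cell K) j s = faceCoord B j s := by
  have hcov : ∀ x ∈ Ioo (B.lower j) (B.upper j),
      ∃ K ∈ T.lineCells j y, x ∈ Icc ((T.cell K).lower j) ((T.cell K).upper j) :=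
    fun x hx => hy.exists_mem_lineCells (hmem x hx)
  have houtside : ∀ K ∈ T.lineCells j y,
      faceCoord B j s ∉ Ioo ((T.cell K).lower j) ((T.cell K).upper j) := fun K hK h =>
    hface (T.Ioo_cell_subset K (insertNth_mem_Ioo.mpr ⟨h, mem_lineCells.mp hK⟩))
  cases s with
  | false =>
    exact exists_left_endpoint_eq (B.lower_lt_upper j)
      (fun K hK h => not_lt.mp fun h' => houtside K hK ⟨h, h'⟩) hcov
  | true =>
    exact exists_right_endpoint_eq (B.lower_lt_upper j)
      (fun K hK h => not_lt.mp fun h' => houtside K hK ⟨h', h⟩) hcov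

theorem sq_line_faceCoord_le {K : Fin T.numCells} (hK : K ∈ T.lineCells j y)
    (hface : facePoint (T.cell K) j s y ∈ Γ) :
    (line v K j y).eval (faceCoord (T.cell K) j s) ^ 2
      ≤ width (T.cell K) j * lineEnergy Γ v j y := by
  rw [mul_comm, ← div_le_iff₀ (width_pos (T.cell K) j)]
  have hterm := indicator_boundary_energyIntegrand_nonneg Γ v
  calc (line v K j y).eval (faceCoord (T.cell K) j s) ^ 2 / width (T.cell K) j
      = Γ.indicator ((energyIntegrand v).boundary K j s) (facePoint (T.cell K) j s y) := by
        rw [indicator_of_mem hface, ← val_insertNth]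
        rfl
    _ ≤ ∑ s, Γ.indicator ((energyIntegrand v).boundary K j s) (facePoint (T.cell K) j s y) :=
        Finset.single_le_sum (f := fun s => Γ.indicator ((energyIntegrand v).boundary K j s)
          (facePoint (T.cell K) j s y)) (fun s _ => hterm K j s _) (Finset.mem_univ s)
    _ ≤ (energyIntegrand v).lineBoundarySum Γ j y :=
        Finset.single_le_sum (f := fun K => ∑ s, Γ.indicator ((energyIntegrand v).boundary K j s)
          (facePoint (T.cell K) j s y)) (fun K _ => Finset.sum_nonneg fun s _ => hterm K j s _) hK
    _ ≤ lineEnergy Γ v j y :=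
        le_add_of_nonneg_left (add_nonneg (lineCellSum_energyIntegrand_nonneg v j y)
          (lineInterfaceSum_energyIntegrand_nonneg v j y))

theorem Generic.ae_sqDensity_le_of_dirichlet (hy : T.Generic j y)
    (hmem : ∀ x ∈ Ioo (B.lower j) (B.upper j), (j.insertNth x y : Fin (n + 1) → ℝ) ∈ Ω)
    (hface : facePoint B j s y ∈ Γ) (hout : facePoint B j s y ∉ Ω) :
    ∀ᵐ t : ℝ, t ∈ Ioo (B.lower j) (B.upper j) →
      sqDensity v (j.insertNth t y) ≤ 6 * Metric.diam Ω * lineEnergy Γ v j y := by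
  obtain ⟨K, hK, hKs⟩ := hy.exists_faceCoord_eq hmem hout
  have hcoord (C : Box (Fin (n + 1))) : faceCoord C j s ∈ Icc (C.lower j) (C.upper j) := by
    have := (C.lower_lt_upper j).le
    cases s <;> simp [faceCoord, this]
  have htrace := sq_line_faceCoord_le (y := y) (Γ := Γ) v hK (by rwa [facePoint, hKs])
  have hwidth := mul_le_mul_of_nonneg_right (width_le_diam hK) (lineEnergy_nonneg Γ v j y)
  filter_upwards [hy.ae_exists_mem_lineCells, Measure.ae_ne volume (faceCoord B j s)]
    with t ht hne htB
  obtain ⟨K', hK', htK'⟩ := ht (hmem t htB)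
  have hdiff := hy.sq_line_sub_le Γ v hK' hK (Ioo_subset_Icc_self htK') (hcoord (T.cell K))
    (hKs ▸ hne) fun x hx =>
      hmem x (uIoo_subset_Ioo (Ioo_subset_Icc_self htB) (hKs ▸ hcoord B) hx)
  rw [sqDensity_insertNth v hK' htK']
  linarith [sq_le_two_mul_add hdiff]

end LineVariation

theorem setIntegral_lineEnergy_le {Γ : Set (Fin (n + 1) → ℝ)} (hΓ : MeasurableSet Γ)
    (v : T.Space k) (j : Fin (n + 1)) (u : Set (Fin n → ℝ)) :
    ∫ y in u, lineEnergy Γ v j y ≤ energy Γ v := by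
  calc ∫ y in u, lineEnergy Γ v j y ≤ ∫ y, lineEnergy Γ v j y :=
        setIntegral_le_integral (MeshIntegrand.integrable_lineSum _ j hΓ)
          (Filter.Eventually.of_forall fun y => lineEnergy_nonneg Γ v j y)
    _ ≤ ∑ j, ∫ y, lineEnergy Γ v j y :=
        Finset.single_le_sum (f := fun j => ∫ y, lineEnergy Γ v j y)
          (fun j _ => integral_nonneg fun y => lineEnergy_nonneg Γ v j y) (Finset.mem_univ j)
    _ = energy Γ v := (MeshIntegrand.meshSum_eq_sum_integral_lineSum _ hΓ).symm

theorem energy_nonneg {Γ : Set (Fin (n + 1) → ℝ)} (hΓ : MeasurableSet Γ) (v : T.Space k) :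
    0 ≤ energy Γ v := by
  simpa using setIntegral_lineEnergy_le hΓ v 0 ∅

end RectMesh

/-! ### The Poincaré–Friedrichs inequality -/

theorem measureReal_mul_integral_le {X Y : Type*} [MeasurableSpace X] [MeasurableSpace Y]
    {μ : Measure X} {ν : Measure Y} [IsFiniteMeasure μ] [IsFiniteMeasure ν] {f : X → ℝ} {g : Y → ℝ}
    {a c : ℝ} (hf : Integrable f μ) (hg : Integrable g ν)
    (h : ∀ᵐ s ∂μ, ∀ᵐ t ∂ν, f s ≤ a * g t + c) :
    ν.real univ * ∫ s, f s ∂μ ≤ μ.real univ * (a * ∫ t, g t ∂ν + ν.real univ * c) := by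
  have hinner : ∀ᵐ s ∂μ, ν.real univ * f s ≤ a * ∫ t, g t ∂ν + ν.real univ * c := by
    filter_upwards [h] with s hs
    calc ν.real univ * f s = ∫ _, f s ∂ν := by simp
      _ ≤ ∫ t, (a * g t + c) ∂ν :=
          integral_mono_ae (integrable_const _) ((hg.const_mul a).add (integrable_const c)) hs
      _ = a * ∫ t, g t ∂ν + ν.real univ * c := by
          rw [integral_add (hg.const_mul a) (integrable_const c), integral_const_mul]
          simp
  calc ν.real univ * ∫ s, f s ∂μ = ∫ s, ν.real univ * f s ∂μ := (integral_const_mul _ _).symm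
    _ ≤ ∫ _, (a * ∫ t, g t ∂ν + ν.real univ * c) ∂μ :=
        integral_mono_ae (hf.const_mul _) (integrable_const _) hinner
    _ = μ.real univ * (a * ∫ t, g t ∂ν + ν.real univ * c) := by simp

/-- The open box with corners `l` and `u`. Unlike a `BoxIntegral.Box`, it may be empty. -/
def openBox {ι : Type*} (l u : ι → ℝ) : Set (ι → ℝ) := univ.pi fun i => Ioo (l i) (u i)

theorem openBox_subset_openBox {ι : Type*} {l u l' u' : ι → ℝ} (hl : l ≤ l') (hu : u' ≤ u) :
    openBox l' u' ⊆ openBox l u :=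
  pi_mono fun i _ => Ioo_subset_Ioo (hl i) (hu i)

theorem insertNth_mem_openBox {l u : Fin (n + 1) → ℝ} {j : Fin (n + 1)} {t : ℝ} {y : Fin n → ℝ} :
    (j.insertNth t y : Fin (n + 1) → ℝ) ∈ openBox l u ↔
      t ∈ Ioo (l j) (u j) ∧ y ∈ openBox (j.removeNth l) (j.removeNth u) := by
  simp only [openBox, mem_univ_pi]
  rw [Fin.forall_iff_succAbove j]
  simp [Fin.removeNth]

theorem measurableSet_openBox {ι : Type*} [Countable ι] (l u : ι → ℝ) :
    MeasurableSet (openBox l u) :=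
  MeasurableSet.univ_pi fun _ => measurableSet_Ioo

theorem ball_eq_openBox {ι : Type*} [Fintype ι] (x : ι → ℝ) {r : ℝ} (hr : 0 < r) :
    Metric.ball x r = openBox (fun i => x i - r) (fun i => x i + r) := by
  simp only [ball_pi _ hr, Real.ball_eq_Ioo, openBox]

namespace RectMesh

variable {T : RectMesh Ω} {k : ℕ} {Γ : Set (Fin (n + 1) → ℝ)} {j : Fin (n + 1)} (v : T.Space k)

theorem Generic.setIntegral_sqDensity_le {y : Fin n → ℝ} (hy : T.Generic j y)
    (hInt : Integrable fun t => sqDensity v (j.insertNth t y)) {α β α' β' : ℝ}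
    (hα : α ≤ α') (hαβ : α' ≤ β') (hβ : β' ≤ β)
    (hmem : ∀ x ∈ Ioo α β, (j.insertNth x y : Fin (n + 1) → ℝ) ∈ Ω) :
    (β' - α') * ∫ t in Ioo α β, sqDensity v (j.insertNth t y)
      ≤ (β - α) * (2 * (∫ t in Ioo α' β', sqDensity v (j.insertNth t y))
        + (β' - α') * (4 * Metric.diam Ω * lineEnergy Γ v j y)) := by
  have hle : ∀ᵐ s ∂volume.restrict (Ioo α β), ∀ᵐ t ∂volume.restrict (Ioo α' β'),
      sqDensity v (j.insertNth s y)
        ≤ 2 * sqDensity v (j.insertNth t y) + 4 * Metric.diam Ω * lineEnergy Γ v j y := by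
    rw [ae_restrict_iff' measurableSet_Ioo]
    filter_upwards [hy.ae_sqDensity_le Γ v hmem] with s hs hsαβ
    rw [ae_restrict_iff' measurableSet_Ioo]
    filter_upwards [hs] with t ht htαβ using ht hsαβ (Ioo_subset_Ioo hα hβ htαβ)
  simpa [measureReal_restrict_apply_univ, Real.volume_real_Ioo_of_le, hαβ, hα.trans (hαβ.trans hβ)]
    using measureReal_mul_integral_le hInt.integrableOn hInt.integrableOn hle

theorem mul_setIntegral_sqDensity_openBox_le (hΓ : MeasurableSet Γ) {l u : Fin (n + 1) → ℝ}
    (hsub : openBox l u ⊆ Ω) {α β : ℝ} (hα : l j ≤ α) (hαβ : α ≤ β) (hβ : β ≤ u j) :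
    (β - α) * ∫ x in openBox l u, sqDensity v x ≤ (u j - l j) *
      (2 * (∫ x in openBox (Function.update l j α) (Function.update u j β), sqDensity v x)
        + (β - α) * (4 * Metric.diam Ω * energy Γ v)) := by
  set U := openBox (j.removeNth l) (j.removeNth u)
  have hmem : ∀ t y, (j.insertNth t y : Fin (n + 1) → ℝ) ∈ openBox l u ↔
      t ∈ Ioo (l j) (u j) ∧ y ∈ U := fun _ _ => insertNth_mem_openBox
  have hmem' : ∀ t y, (j.insertNth t y : Fin (n + 1) → ℝ) ∈
      openBox (Function.update l j α) (Function.update u j β) ↔ t ∈ Ioo α β ∧ y ∈ U := by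
    simp [insertNth_mem_openBox, U]
  have hv {A : Set (Fin (n + 1) → ℝ)} : IntegrableOn (sqDensity v) A :=
    (integrable_sqDensity v).integrableOn
  have hInt : IntegrableOn (fun y => ∫ t in Ioo (l j) (u j), sqDensity v (j.insertNth t y)) U :=
    (integrable_insertNth hmem hv).integral_prod_right
  have hInt' : IntegrableOn (fun y => ∫ t in Ioo α β, sqDensity v (j.insertNth t y)) U :=
    (integrable_insertNth hmem' hv).integral_prod_right
  have hE : IntegrableOn (lineEnergy Γ v j) U :=
    (MeshIntegrand.integrable_lineSum (energyIntegrand v) j hΓ).integrableOn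
  calc (β - α) * ∫ x in openBox l u, sqDensity v x
      = ∫ y in U, (β - α) * ∫ t in Ioo (l j) (u j), sqDensity v (j.insertNth t y) := by
        rw [setIntegral_insertNth hmem hv, integral_const_mul]
    _ ≤ ∫ y in U, (u j - l j) * (2 * (∫ t in Ioo α β, sqDensity v (j.insertNth t y))
          + (β - α) * (4 * Metric.diam Ω * lineEnergy Γ v j y)) := by
        refine setIntegral_mono_on_ae (hInt.const_mul _) (((hInt'.const_mul _).add
          ((hE.const_mul _).const_mul _)).const_mul _) (measurableSet_openBox _ _) ?_
        filter_upwards [ae_generic T j, ae_integrable_sqDensity_insertNth v j] with y hy hyint hyU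
        exact hy.setIntegral_sqDensity_le v hyint hα hαβ hβ fun x hx =>
          hsub ((hmem x y).mpr ⟨hx, hyU⟩)
    _ = (u j - l j) *
          (2 * (∫ x in openBox (Function.update l j α) (Function.update u j β), sqDensity v x)
            + (β - α) * (4 * Metric.diam Ω * ∫ y in U, lineEnergy Γ v j y)) := by
        rw [setIntegral_insertNth hmem' hv, integral_const_mul,
          integral_add (hInt'.const_mul _) ((hE.const_mul _).const_mul _), integral_const_mul,
          integral_const_mul, integral_const_mul]
    _ ≤ _ := by
        have := setIntegral_lineEnergy_le hΓ v j U
        have := sub_nonneg.mpr hαβ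
        have := sub_nonneg.mpr (hα.trans (hαβ.trans hβ))
        gcongr

theorem setIntegral_sqDensity_le_of_dirichlet (hΓ : MeasurableSet Γ) (hdisj : Disjoint Γ Ω)
    {B : Box (Fin (n + 1))} (hB : Box.Ioo B ⊆ Ω) {s : Bool} (hface : closedFace B j s ⊆ Γ) :
    ∫ x in Box.Ioo B, sqDensity v x ≤ width B j * (6 * Metric.diam Ω * energy Γ v) := by
  have hv := (integrable_sqDensity v).integrableOn (s := Box.Ioo B)
  have hE := (MeshIntegrand.integrable_lineSum (energyIntegrand v) j hΓ).integrableOn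
    (s := Box.Ioo (B.face j))
  have hw := (width_pos B j).le
  calc ∫ x in Box.Ioo B, sqDensity v x
      = ∫ y in Box.Ioo (B.face j), ∫ t in Ioo (B.lower j) (B.upper j),
          sqDensity v (j.insertNth t y) := setIntegral_insertNth (fun _ _ => insertNth_mem_Ioo) hv
    _ ≤ ∫ y in Box.Ioo (B.face j), width B j * (6 * Metric.diam Ω * lineEnergy Γ v j y) := by
        refine setIntegral_mono_on_ae
          (integrable_insertNth (fun _ _ => insertNth_mem_Ioo) hv).integral_prod_right
          ((hE.const_mul _).const_mul _) (isOpen_boxIoo _).measurableSet ?_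
        filter_upwards [ae_generic T j, ae_integrable_sqDensity_insertNth v j] with y hy hyint hyB
        have hmem := hface ⟨y, Box.Ioo_subset_Icc _ hyB, rfl⟩
        refine (setIntegral_mono_on_ae hyint.integrableOn (integrableOn_const (by simp))
          measurableSet_Ioo (hy.ae_sqDensity_le_of_dirichlet v
            (fun x hx => hB (insertNth_mem_Ioo.mpr ⟨hx, hyB⟩)) hmem
            (disjoint_left.mp hdisj hmem))).trans_eq ?_
        simp [width, (B.lower_lt_upper j).le]
    _ = width B j * (6 * Metric.diam Ω * ∫ y in Box.Ioo (B.face j), lineEnergy Γ v j y) := by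
        rw [integral_const_mul, integral_const_mul]
    _ ≤ _ := by
        have := setIntegral_lineEnergy_le hΓ v j (Box.Ioo (B.face j))
        gcongr

end RectMesh

/-- On `A`, the squares of all piecewise polynomials of degree at most `k` on all meshes of `Ω` are
controlled by the energy with Dirichlet part `Γ`. -/
def Controlled (Ω Γ : Set (Fin (n + 1) → ℝ)) (k : ℕ) (A : Set (Fin (n + 1) → ℝ)) : Prop :=
  ∃ C : ℝ, ∀ (T : RectMesh Ω) (v : T.Space k),
    ∫ x in A, RectMesh.sqDensity v x ≤ C * RectMesh.energy Γ v

namespace Controlled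

open RectMesh

variable {Γ : Set (Fin (n + 1) → ℝ)} {k : ℕ}

theorem mono {A B : Set (Fin (n + 1) → ℝ)} (hA : Controlled Ω Γ k A) (hBA : B ≤ᵐ[volume] A) :
    Controlled Ω Γ k B := by
  obtain ⟨C, hC⟩ := hA
  refine ⟨C, fun T v => le_trans ?_ (hC T v)⟩
  exact setIntegral_mono_set (integrable_sqDensity v).integrableOn
    (Filter.Eventually.of_forall (sqDensity_nonneg v)) hBA

theorem widen (hΓ : MeasurableSet Γ) {l u : Fin (n + 1) → ℝ} (hsub : openBox l u ⊆ Ω)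
    {j : Fin (n + 1)} {α β : ℝ} (hα : l j ≤ α) (hαβ : α < β) (hβ : β ≤ u j)
    (h : Controlled Ω Γ k (openBox (Function.update l j α) (Function.update u j β))) :
    Controlled Ω Γ k (openBox l u) := by
  obtain ⟨C, hC⟩ := h
  have hlen : 0 ≤ u j - l j := sub_nonneg.mpr (hα.trans (hαβ.le.trans hβ))
  refine ⟨(u j - l j) * (2 * C + (β - α) * (4 * Metric.diam Ω)) / (β - α), fun T v => ?_⟩
  rw [div_mul_eq_mul_div, le_div_iff₀' (sub_pos.mpr hαβ)]
  refine (mul_setIntegral_sqDensity_openBox_le v hΓ hsub hα hαβ.le hβ).trans ?_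
  rw [mul_assoc (u j - l j) _ (energy Γ v)]
  refine mul_le_mul_of_nonneg_left ?_ hlen
  linarith [hC T v]

theorem of_subbox (hΓ : MeasurableSet Γ) {l u l' u' : Fin (n + 1) → ℝ} (hsub : openBox l u ⊆ Ω)
    (hl : l ≤ l') (hlu : ∀ i, l' i < u' i) (hu : u' ≤ u)
    (h : Controlled Ω Γ k (openBox l' u')) : Controlled Ω Γ k (openBox l u) := by
  suffices H : ∀ s : Finset (Fin (n + 1)),
      Controlled Ω Γ k (openBox (s.piecewise l l') (s.piecewise u u')) by
    simpa using H Finset.univ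
  intro s
  induction s using Finset.induction_on with
  | empty => simpa using h
  | insert j s hj ih =>
    refine widen hΓ ((openBox_subset_openBox
      (Finset.le_piecewise_of_le_of_le _ le_rfl hl)
      (Finset.piecewise_le_of_le_of_le _ le_rfl hu)).trans hsub)
      (j := j) (α := l' j) (β := u' j) ?_ (hlu j) ?_ ?_
    · simpa using hl j
    · simpa using hu j
    · rw [Finset.piecewise_insert, Finset.piecewise_insert, Function.update_idem,
        Function.update_idem, Function.update_eq_self_iff.mpr, Function.update_eq_self_iff.mpr]
      · exact ih
      · simp [hj]
      · simp [hj]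

theorem of_dirichlet (hΓ : MeasurableSet Γ) (hdisj : Disjoint Γ Ω) {B : Box (Fin (n + 1))}
    (hB : Box.Ioo B ⊆ Ω) {j : Fin (n + 1)} {s : Bool} (hface : closedFace B j s ⊆ Γ) :
    Controlled Ω Γ k (Box.Ioo B) :=
  ⟨width B j * (6 * Metric.diam Ω), fun _ v =>
    (setIntegral_sqDensity_le_of_dirichlet v hΓ hdisj hB hface).trans_eq (mul_assoc _ _ _).symm⟩

theorem iUnion {ι : Type*} [Finite ι] {A : ι → Set (Fin (n + 1) → ℝ)}
    (h : ∀ i, Controlled Ω Γ k (A i)) : Controlled Ω Γ k (⋃ i, A i) := by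
  have := Fintype.ofFinite ι
  choose C hC using h
  refine ⟨∑ i, C i, fun T v => ?_⟩
  have hv := integrable_sqDensity v
  calc ∫ x in ⋃ i, A i, sqDensity v x
      ≤ ∫ x, sqDensity v x ∂∑ i, volume.restrict (A i) := by
        refine integral_mono_measure ?_ (Filter.Eventually.of_forall (sqDensity_nonneg v))
          (integrable_finsetSum_measure.mpr fun i _ => hv.restrict)
        exact Measure.restrict_iUnion_le.trans_eq (Measure.sum_fintype _)
    _ = ∑ i, ∫ x in A i, sqDensity v x := integral_finsetSum_measure fun i _ => hv.restrict
    _ ≤ (∑ i, C i) * energy Γ v := by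
        rw [Finset.sum_mul]
        exact Finset.sum_le_sum fun i _ => hC i T v

theorem openBox_of_ball (hΓ : MeasurableSet Γ) {l u : Fin (n + 1) → ℝ} (hsub : openBox l u ⊆ Ω)
    {x : Fin (n + 1) → ℝ} (hx : x ∈ openBox l u) {r : ℝ} (hr : 0 < r)
    (h : Controlled Ω Γ k (Metric.ball x r)) : Controlled Ω Γ k (openBox l u) := by
  have hx' : ∀ i, l i < x i ∧ x i < u i := by simpa [openBox] using hx
  rw [ball_eq_openBox x hr] at h
  refine of_subbox hΓ hsub (l' := fun i => max (l i) (x i - r)) (u' := fun i => min (u i) (x i + r))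
    (fun i => le_max_left _ _) (fun i => ?_) (fun i => min_le_left _ _)
    (h.mono (openBox_subset_openBox (fun i => le_max_right _ _)
      fun i => min_le_right _ _).eventuallyLE)
  have := hx' i
  simp only [max_lt_iff, lt_min_iff]
  constructor <;> constructor <;> linarith

theorem exists_ball (hΩ : IsOpen Ω) (hconn : IsPreconnected Ω) (hΓ : MeasurableSet Γ)
    {x₀ : Fin (n + 1) → ℝ} (hx₀ : x₀ ∈ Ω) {U : Set (Fin (n + 1) → ℝ)} (hU : U ∈ nhds x₀)
    (h : Controlled Ω Γ k U) {x : Fin (n + 1) → ℝ} (hx : x ∈ Ω) :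
    ∃ r > 0, Controlled Ω Γ k (Metric.ball x r) := by
  set V : Set (Fin (n + 1) → ℝ) := {x | ∃ r > 0, Controlled Ω Γ k (Metric.ball x r)}
  have hV : ∀ {A z}, Controlled Ω Γ k A → A ∈ nhds z → z ∈ V := fun hA hz => by
    obtain ⟨r, hr, hball⟩ := Metric.mem_nhds_iff.mp hz
    exact ⟨r, hr, hA.mono hball.eventuallyLE⟩
  have hopen : IsOpen V := isOpen_iff_mem_nhds.mpr fun z ⟨r, hr, hz⟩ =>
    Filter.mem_of_superset (Metric.ball_mem_nhds z hr) fun _ hy =>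
      hV hz (Metric.isOpen_ball.mem_nhds hy)
  -- `V` is closed in `Ω`, because control spreads from any ball to a box that contains its center.
  refine hconn.subset_of_closure_inter_subset hopen ⟨x₀, hx₀, hV h hU⟩ ?_ hx
  rintro z ⟨hzV, hzΩ⟩
  obtain ⟨r, hr, hball⟩ := Metric.isOpen_iff.mp hΩ z hzΩ
  obtain ⟨q, hq, ρ, hρ, hqρ⟩ := mem_closure_iff_nhds.mp hzV _ (Metric.ball_mem_nhds z hr)
  refine ⟨r, hr, ?_⟩
  rw [ball_eq_openBox z hr] at hball hq ⊢
  exact openBox_of_ball hΓ hball hq hρ hqρ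

theorem domain (hconn : IsPreconnected Ω) (hΓ : MeasurableSet Γ) (hdisj : Disjoint Γ Ω)
    (hne : Γ.Nonempty) {T₀ : RectMesh Ω} (hT₀ : T₀.Resolves Γ) : Controlled Ω Γ k Ω := by
  obtain ⟨x₀, hx₀⟩ := hne
  obtain ⟨K₀, j, s, -, hface⟩ := hT₀ x₀ hx₀
  have hcenter : ∀ B : Box (Fin (n + 1)), ∃ c, c ∈ Box.Ioo B := fun B =>
    ⟨fun i => (B.lower i + B.upper i) / 2, mem_boxIoo.mpr fun i => by
      have := B.lower_lt_upper i
      constructor <;> linarith⟩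
  obtain ⟨c₀, hc₀⟩ := hcenter (T₀.cell K₀)
  refine mono (iUnion fun K => ?_) T₀.subset_iUnion_Icc_cell.eventuallyLE
  obtain ⟨c, hc⟩ := hcenter (T₀.cell K)
  obtain ⟨r, hr, hcr⟩ := exists_ball T₀.isOpen hconn hΓ (T₀.Ioo_cell_subset K₀ hc₀)
    ((isOpen_boxIoo _).mem_nhds hc₀) (of_dirichlet hΓ hdisj (T₀.Ioo_cell_subset K₀) hface)
    (T₀.Ioo_cell_subset K hc)
  exact (openBox_of_ball hΓ (T₀.Ioo_cell_subset K) hc hr hcr).mono (Box.Ioo_ae_eq_Icc _).symm.le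

end Controlled

namespace RectMesh

theorem setIntegral_sqDensity {T : RectMesh Ω} {k : ℕ} (v : T.Space k) :
    ∫ x in Ω, sqDensity v x = l2norm v ^ 2 := by
  rw [l2norm_sq_eq_integral_sqDensity]
  exact setIntegral_eq_integral_of_forall_compl_eq_zero fun x hx => Finset.sum_eq_zero fun K _ =>
    indicator_of_notMem (fun hK => hx (T.Ioo_cell_subset K hK)) _

theorem exists_l2norm_sq_le_mul_energy {Γ : Set (Fin (n + 1) → ℝ)} (hconn : IsPreconnected Ω)
    (hΓ : MeasurableSet Γ) (hdisj : Disjoint Γ Ω) (hne : Γ.Nonempty) {T₀ : RectMesh Ω}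
    (hT₀ : T₀.Resolves Γ) (k : ℕ) :
    ∃ C : ℝ, ∀ (T : RectMesh Ω) (v : T.Space k), l2norm v ^ 2 ≤ C * energy Γ v := by
  obtain ⟨C, hC⟩ := Controlled.domain (k := k) hconn hΓ hdisj hne hT₀
  exact ⟨C, fun T v => setIntegral_sqDensity v ▸ hC T v⟩

end RectMesh

/-! ### Linearity of the forms -/

/-- The linear functional given by a function that preserves the combinations `a • x + y`. -/
def linearOfSmulAdd {V : Type*} [AddCommGroup V] [Module ℝ V] (F : V → ℝ)
    (hF : ∀ (a : ℝ) x y, F (a • x + y) = a * F x + F y) : V →ₗ[ℝ] ℝ where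
  toFun := F
  map_add' x y := by simpa using hF 1 x y
  map_smul' a x := by
    have h0 : F 0 = 0 := by simpa using hF 1 0 0
    simpa [h0] using hF a x 0

/-- The bilinear form given by a function that preserves the combinations `a • x + y` in each
argument. -/
def bilinOfSmulAdd {V : Type*} [AddCommGroup V] [Module ℝ V] (F : V → V → ℝ)
    (hl : ∀ (a : ℝ) x x' y, F (a • x + x') y = a * F x y + F x' y)
    (hr : ∀ (a : ℝ) x y y', F x (a • y + y') = a * F x y + F x y') : LinearMap.BilinForm ℝ V :=
  LinearMap.mk₂ ℝ F
    (fun x x' y => (linearOfSmulAdd (F · y) fun a x x' => hl a x x' y).map_add x x')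
    (fun a x y => (linearOfSmulAdd (F · y) fun a x x' => hl a x x' y).map_smul a x)
    (fun x y y' => (linearOfSmulAdd (F x) fun a => hr a x).map_add y y')
    (fun a x y => (linearOfSmulAdd (F x) fun a => hr a x).map_smul a y)

theorem setIntegral_eq_mul_add {X : Type*} [MeasurableSpace X] {μ : Measure X} {A : Set X}
    {f g h : X → ℝ} {a : ℝ} (hg : IntegrableOn g A μ) (hh : IntegrableOn h A μ)
    (hf : ∀ x, f x = a * g x + h x) :
    ∫ x in A, f x ∂μ = a * (∫ x in A, g x ∂μ) + ∫ x in A, h x ∂μ := by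
  simp only [hf]
  rw [integral_add (hg.const_mul a) hh, integral_const_mul]

namespace RectMesh

variable {T : RectMesh Ω} {k : ℕ} {Γ : Set (Fin (n + 1) → ℝ)}

section SmulAdd

variable (a : ℝ) (v w : T.Space k)

theorem val_smul_add (K : Fin T.numCells) (x : Fin (n + 1) → ℝ) :
    val (a • v + w) K x = a * val v K x + val w K x := by
  simp [val, MvPolynomial.smul_eval]

theorem d1_smul_add (K : Fin T.numCells) (j : Fin (n + 1)) (x : Fin (n + 1) → ℝ) :
    d1 (a • v + w) K j x = a * d1 v K j x + d1 w K j x := by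
  simp [d1, MvPolynomial.smul_eval]

theorem d2_smul_add (K : Fin T.numCells) (j : Fin (n + 1)) (x : Fin (n + 1) → ℝ) :
    d2 (a • v + w) K j x = a * d2 v K j x + d2 w K j x := by
  simp [d2, MvPolynomial.smul_eval]

theorem jump_smul_add (K₁ K₂ : Fin T.numCells) (x : Fin (n + 1) → ℝ) :
    jump (a • v + w) K₁ K₂ x = a * jump v K₁ K₂ x + jump w K₁ K₂ x := by
  simp only [jump, val_smul_add]
  ring

theorem avgD1_smul_add (K₁ K₂ : Fin T.numCells) (j : Fin (n + 1)) (x : Fin (n + 1) → ℝ) :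
    avgD1 (a • v + w) K₁ K₂ j x = a * avgD1 v K₁ K₂ j x + avgD1 w K₁ K₂ j x := by
  simp only [avgD1, d1_smul_add]
  ring

theorem flux_smul_add (β₀ β₁ : ℝ) (K₁ K₂ : Fin T.numCells) (j : Fin (n + 1))
    (x : Fin (n + 1) → ℝ) :
    flux β₀ β₁ (a • v + w) K₁ K₂ j x = a * flux β₀ β₁ v K₁ K₂ j x + flux β₀ β₁ w K₁ K₂ j x := by
  simp only [flux, jumpD2, jump_smul_add, avgD1_smul_add, d2_smul_add]
  ring

end SmulAdd

/-- Integrability of the integrand of `T.boundaryIntegral Γ f` on each face. -/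
def FaceIntegrable (T : RectMesh Ω) (Γ : Set (Fin (n + 1) → ℝ))
    (f : Fin T.numCells → Fin (n + 1) → Bool → (Fin (n + 1) → ℝ) → ℝ) : Prop :=
  ∀ K j s, IntegrableOn (fun y => f K j s (facePoint (T.cell K) j s y)) (T.faceIn Γ K j s)

theorem boundaryIntegral_eq_mul_add {a : ℝ}
    {f g h : Fin T.numCells → Fin (n + 1) → Bool → (Fin (n + 1) → ℝ) → ℝ}
    (hg : T.FaceIntegrable Γ g) (hh : T.FaceIntegrable Γ h)
    (hf : ∀ K j s x, f K j s x = a * g K j s x + h K j s x) :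
    T.boundaryIntegral Γ f = a * T.boundaryIntegral Γ g + T.boundaryIntegral Γ h := by
  simp only [boundaryIntegral, Finset.mul_sum, ← Finset.sum_add_distrib]
  exact Finset.sum_congr rfl fun K _ => Finset.sum_congr rfl fun j _ => Finset.sum_congr rfl
    fun s _ => setIntegral_eq_mul_add (hg K j s) (hh K j s) fun y => hf K j s _

theorem BoundaryIntegrable.faceIntegrable_mul {g : (Fin (n + 1) → ℝ) → ℝ}
    (hg : T.BoundaryIntegrable Γ g) (hΓ : MeasurableSet Γ)
    {f : Fin T.numCells → Fin (n + 1) → Bool → (Fin (n + 1) → ℝ) → ℝ}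
    (hf : ∀ K j s, Continuous (f K j s)) :
    T.FaceIntegrable Γ fun K j s x => f K j s x * g x := fun K j s =>
  (hg K j s).continuousOn_mul_of_subset ((hf K j s).comp (by fun_prop)).continuousOn
    (Box.isCompact_Icc _)
    ((measurableSet_boxIcc _).inter ((continuous_facePoint _ j s).measurable hΓ))
    inter_subset_left

theorem MeshIntegrand.faceIntegrable (F : MeshIntegrand T) : T.FaceIntegrable Γ F.boundary :=
  fun K j s => (F.integrableOn_comp_facePoint j K s).mono_set inter_subset_left

theorem MeshIntegrand.interfaceIntegral_eq_mul_add {F G H : MeshIntegrand T} {a : ℝ}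
    (h : ∀ K₁ K₂ j x, F.interface K₁ K₂ j x = a * G.interface K₁ K₂ j x + H.interface K₁ K₂ j x) :
    T.interfaceIntegral F.interface
      = a * T.interfaceIntegral G.interface + T.interfaceIntegral H.interface := by
  have hInt (F : MeshIntegrand T) (K₁ K₂ j) :
      IntegrableOn (fun y => F.interface K₁ K₂ j (facePoint (T.cell K₁) j true y))
        (Box.Icc ((T.cell K₁).face j) ∩ Box.Icc ((T.cell K₂).face j)) :=
    (integrableOn_boxIcc _ ((F.continuous_interface K₁ K₂ j).comp
      (continuous_facePoint (T.cell K₁) j true))).mono_set inter_subset_left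
  simp only [interfaceIntegral, Finset.mul_sum, ← Finset.sum_add_distrib]
  refine Finset.sum_congr rfl fun j _ => Finset.sum_congr rfl fun K₁ _ =>
    Finset.sum_congr rfl fun K₂ _ => ?_
  split_ifs
  · exact setIntegral_eq_mul_add (hInt G K₁ K₂ j) (hInt H K₁ K₂ j) fun y => h K₁ K₂ j _
  · simp

theorem MeshIntegrand.meshSum_eq_mul_add {F G H : MeshIntegrand T} {a : ℝ}
    (hcell : ∀ K j x, F.cell K j x = a * G.cell K j x + H.cell K j x)
    (hinterface : ∀ K₁ K₂ j x,
      F.interface K₁ K₂ j x = a * G.interface K₁ K₂ j x + H.interface K₁ K₂ j x)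
    (hboundary : ∀ K j s x, F.boundary K j s x = a * G.boundary K j s x + H.boundary K j s x) :
    F.meshSum Γ = a * G.meshSum Γ + H.meshSum Γ := by
  have hInt (F : MeshIntegrand T) (K) :
      IntegrableOn (fun x => ∑ j, F.cell K j x) (Box.Icc (T.cell K)) :=
    integrable_finsetSum _ fun j _ => integrableOn_boxIcc _ (F.continuous_cell K j)
  have hcells (K) : ∫ x in Box.Icc (T.cell K), ∑ j, F.cell K j x
      = a * (∫ x in Box.Icc (T.cell K), ∑ j, G.cell K j x)
        + ∫ x in Box.Icc (T.cell K), ∑ j, H.cell K j x :=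
    setIntegral_eq_mul_add (hInt G K) (hInt H K) fun x => by
      simp only [hcell, Finset.mul_sum, Finset.sum_add_distrib]
  simp only [meshSum, hcells, interfaceIntegral_eq_mul_add hinterface,
    boundaryIntegral_eq_mul_add G.faceIntegrable H.faceIntegrable hboundary,
    Finset.sum_add_distrib, ← Finset.mul_sum]
  ring

theorem formA_smul_add_left (Γ : Set (Fin (n + 1) → ℝ)) (β₀ β₁ a : ℝ) (ψ ψ' η : T.Space k) :
    formA Γ β₀ β₁ (a • ψ + ψ') η = a * formA Γ β₀ β₁ ψ η + formA Γ β₀ β₁ ψ' η := by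
  refine MeshIntegrand.meshSum_eq_mul_add (F := formIntegrand β₀ β₁ (a • ψ + ψ') η)
    (G := formIntegrand β₀ β₁ ψ η) (H := formIntegrand β₀ β₁ ψ' η) ?_ ?_ ?_ <;>
  · intros
    simp only [formIntegrand, d1_smul_add, val_smul_add, jump_smul_add, flux_smul_add]
    ring

theorem formA_smul_add_right (Γ : Set (Fin (n + 1) → ℝ)) (β₀ β₁ a : ℝ) (ψ η η' : T.Space k) :
    formA Γ β₀ β₁ ψ (a • η + η') = a * formA Γ β₀ β₁ ψ η + formA Γ β₀ β₁ ψ η' := by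
  refine MeshIntegrand.meshSum_eq_mul_add (F := formIntegrand β₀ β₁ ψ (a • η + η'))
    (G := formIntegrand β₀ β₁ ψ η) (H := formIntegrand β₀ β₁ ψ η') ?_ ?_ ?_ <;>
  · intros
    simp only [formIntegrand, d1_smul_add, val_smul_add, jump_smul_add, avgD1_smul_add]
    ring

/-- `formA` as a bundled bilinear form. -/
def bilinA (T : RectMesh Ω) (k : ℕ) (Γ : Set (Fin (n + 1) → ℝ)) (β₀ β₁ : ℝ) :
    LinearMap.BilinForm ℝ (T.Space k) :=
  bilinOfSmulAdd (formA Γ β₀ β₁) (formA_smul_add_left Γ β₀ β₁) (formA_smul_add_right Γ β₀ β₁)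

section Load

variable {m : ℕ} (q : Fin m → ℝ) {ρ₀ ψD σ : (Fin (n + 1) → ℝ) → ℝ} (hρ : IntegrableOn ρ₀ Ω)
include hρ

theorem integrableOn_source (c : Fin m → T.Space k) (η : T.Space k) (K : Fin T.numCells) :
    IntegrableOn (fun x => ((∑ i, q i * val (c i) K x) + ρ₀ x) * val η K x)
      (Box.Icc (T.cell K)) := by
  have hρK : IntegrableOn ρ₀ (Box.Icc (T.cell K)) :=
    (hρ.mono_set (T.Ioo_cell_subset K)).congr_set_ae (Box.Ioo_ae_eq_Icc _).symm
  exact ((integrableOn_boxIcc _ (by fun_prop)).add hρK).mul_continuousOn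
    (continuous_val η K).continuousOn (Box.isCompact_Icc _)

theorem formL_smul_add (hΓ : MeasurableSet Γ) (β₀ : ℝ) (hψ : T.BoundaryIntegrable Γ ψD)
    (hσ : T.BoundaryIntegrable (frontier Ω \ Γ) σ) (c : Fin m → T.Space k) (a : ℝ)
    (η η' : T.Space k) :
    formL Γ β₀ q ρ₀ ψD σ c (a • η + η')
      = a * formL Γ β₀ q ρ₀ ψD σ c η + formL Γ β₀ q ρ₀ ψD σ c η' := by
  have hsource (K) := setIntegral_eq_mul_add (a := a) (integrableOn_source q hρ c η K)
    (integrableOn_source q hρ c η' K) fun x => by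
      rw [mul_left_comm, ← mul_add, ← val_smul_add a η η' K x]
  have hdirichlet (η : T.Space k) : T.FaceIntegrable Γ fun K j s x =>
      (β₀ / width (T.cell K) j * val η K x - normalSign s * d1 η K j x) * ψD x :=
    hψ.faceIntegrable_mul hΓ fun K j s => by fun_prop
  have hneumann (η : T.Space k) :
      T.FaceIntegrable (frontier Ω \ Γ) fun K _ _ x => σ x * val η K x := by
    simpa only [mul_comm] using hσ.faceIntegrable_mul (isClosed_frontier.measurableSet.diff hΓ)
      fun K _ _ => continuous_val η K
  simp only [formL, hsource, Finset.sum_add_distrib, ← Finset.mul_sum]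
  rw [boundaryIntegral_eq_mul_add (a := a) (hdirichlet η) (hdirichlet η'),
    boundaryIntegral_eq_mul_add (a := a) (hneumann η) (hneumann η')]
  · ring
  · intros
    rw [val_smul_add]
    ring
  · intros
    rw [val_smul_add, d1_smul_add]
    ring

end Load

/-! ### The `L²` inner product -/

/-- The `L²(Ω)` inner product on `V_h`. -/
def l2inner (u v : T.Space k) : ℝ := ∑ K, ∫ x in Box.Icc (T.cell K), val u K x * val v K x

theorem l2inner_comm (u v : T.Space k) : l2inner u v = l2inner v u := by
  simp only [l2inner, mul_comm]

theorem l2inner_smul_add_left (a : ℝ) (u u' v : T.Space k) :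
    l2inner (a • u + u') v = a * l2inner u v + l2inner u' v := by
  simp only [l2inner, Finset.mul_sum, ← Finset.sum_add_distrib]
  exact Finset.sum_congr rfl fun K _ => setIntegral_eq_mul_add
    (integrableOn_boxIcc _ (by fun_prop)) (integrableOn_boxIcc _ (by fun_prop)) fun x => by
      rw [val_smul_add]
      ring

theorem l2inner_self (v : T.Space k) : l2inner v v = l2norm v ^ 2 := by
  rw [l2norm_sq]
  simp only [l2inner, sq]

/-- `l2inner` as a bundled bilinear form. -/
def l2Form (T : RectMesh Ω) (k : ℕ) : LinearMap.BilinForm ℝ (T.Space k) :=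
  bilinOfSmulAdd l2inner l2inner_smul_add_left fun a u v v' => by
    rw [l2inner_comm, l2inner_smul_add_left, l2inner_comm v u, l2inner_comm v' u]

theorem l2norm_nonneg (v : T.Space k) : 0 ≤ l2norm v := Real.sqrt_nonneg _

theorem abs_l2inner_le (u v : T.Space k) : |l2inner u v| ≤ l2norm u * l2norm v := by
  have h : l2inner u v ^ 2 ≤ l2inner u u * l2inner v v :=
    LinearMap.BilinForm.apply_sq_le_of_symm (l2Form T k)
      (fun v => (sq_nonneg _).trans_eq (l2inner_self v).symm) ⟨l2inner_comm⟩ u v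
  rw [l2inner_self, l2inner_self, ← mul_pow] at h
  exact abs_le_of_sq_le_sq h (mul_nonneg (l2norm_nonneg u) (l2norm_nonneg v))

theorem eq_zero_of_l2norm_eq_zero {v : T.Space k} (h : l2norm v = 0) : v = 0 := by
  have hsum := l2norm_sq v
  rw [h, zero_pow two_ne_zero] at hsum
  have hcell := (Finset.sum_eq_zero_iff_of_nonneg fun K _ => setIntegral_nonneg
    (measurableSet_boxIcc (T.cell K)) fun x _ => sq_nonneg (val v K x)).mp hsum.symm
  funext K
  have hae := hcell K (Finset.mem_univ K)
  rw [setIntegral_eq_zero_iff_of_nonneg_ae (Filter.Eventually.of_forall fun x => sq_nonneg _)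
    (integrableOn_boxIcc _ (by fun_prop))] at hae
  have hzero : EqOn (fun x => val v K x ^ 2) 0 (Box.Ioo (T.cell K)) :=
    Measure.eqOn_open_of_ae_eq (ae_restrict_of_ae_restrict_of_subset (Box.Ioo_subset_Icc _) hae)
      (isOpen_boxIoo _) ((continuous_val v K).pow 2).continuousOn continuousOn_const
  refine Subtype.ext (MvPolynomial.funext_set
    (fun i => Ioo ((T.cell K).lower i) ((T.cell K).upper i))
    (fun i => Ioo_infinite ((T.cell K).lower_lt_upper i)) fun x hx => ?_)
  have : val v K x ^ 2 = 0 := hzero (show x ∈ Box.Ioo (T.cell K) from hx)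
  simpa [val] using this

theorem formL_sub (β₀ : ℝ) {m : ℕ} (q : Fin m → ℝ) {ρ₀ ψD σ : (Fin (n + 1) → ℝ) → ℝ}
    (hρ : IntegrableOn ρ₀ Ω) (c c' : Fin m → T.Space k) (η : T.Space k) :
    formL Γ β₀ q ρ₀ ψD σ c η - formL Γ β₀ q ρ₀ ψD σ c' η = ∑ i, q i * l2inner (c i - c' i) η := by
  have hval (i K x) : val (c i - c' i) K x = val (c i) K x - val (c' i) K x := by simp [val]
  simp only [formL, l2inner, Finset.mul_sum]
  rw [Finset.sum_comm, add_sub_add_right_eq_sub, add_sub_add_right_eq_sub, ← Finset.sum_sub_distrib]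
  refine Finset.sum_congr rfl fun K _ => ?_
  simp only [← integral_const_mul]
  rw [← integral_sub (integrableOn_source q hρ c η K) (integrableOn_source q hρ c' η K),
    ← integral_finsetSum _ fun i _ => integrableOn_boxIcc _ (by fun_prop)]
  refine integral_congr_ae (Filter.Eventually.of_forall fun x => ?_)
  simp only [hval]
  rw [← sub_mul, add_sub_add_right_eq_sub, ← Finset.sum_sub_distrib, Finset.sum_mul]
  exact Finset.sum_congr rfl fun i _ => by ring

theorem formL_sub_le (β₀ : ℝ) {m : ℕ} (q : Fin m → ℝ) {ρ₀ ψD σ : (Fin (n + 1) → ℝ) → ℝ}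
    (hρ : IntegrableOn ρ₀ Ω) (c c' : Fin m → T.Space k) (η : T.Space k) :
    formL Γ β₀ q ρ₀ ψD σ c η - formL Γ β₀ q ρ₀ ψD σ c' η
      ≤ (∑ i, |q i| * l2norm (c i - c' i)) * l2norm η := by
  rw [formL_sub β₀ q hρ, Finset.sum_mul]
  refine Finset.sum_le_sum fun i _ => ?_
  calc q i * l2inner (c i - c' i) η ≤ |q i| * |l2inner (c i - c' i) η| :=
        (le_abs_self _).trans_eq (abs_mul _ _)
    _ ≤ |q i| * (l2norm (c i - c' i) * l2norm η) := by
        gcongr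
        exact abs_l2inner_le _ _
    _ = |q i| * l2norm (c i - c' i) * l2norm η := (mul_assoc _ _ _).symm

end RectMesh

/-! ### Existence, uniqueness and stability -/

theorem existsUnique_of_apply_self_eq_zero {𝕜 V : Type*} [Field 𝕜] [AddCommGroup V] [Module 𝕜 V]
    [FiniteDimensional 𝕜 V] (B : LinearMap.BilinForm 𝕜 V) (hB : ∀ v, B v v = 0 → v = 0)
    (f : Module.Dual 𝕜 V) : ∃! u, B u = f := by
  have hinj : Function.Injective B := (injective_iff_map_eq_zero B).mpr fun v hv =>
    hB v (LinearMap.congr_fun hv v)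
  have hsurj : Function.Surjective B :=
    (LinearMap.injective_iff_surjective_of_finrank_eq_finrank
      Subspace.dual_finrank_eq.symm).mp hinj
  exact Function.Bijective.existsUnique ⟨hinj, hsurj⟩ f

namespace RectMesh

variable {T : RectMesh Ω} {k : ℕ} {Γ : Set (Fin (n + 1) → ℝ)}

theorem Resolves.measurableSet (h : T.Resolves Γ) : MeasurableSet Γ := by
  have hΓ : Γ = ⋃ (K) (j) (s) (_ : closedFace (T.cell K) j s ⊆ Γ), closedFace (T.cell K) j s := by
    refine Subset.antisymm (fun x hx => ?_) (by simp)
    obtain ⟨K, j, s, hxF, hF⟩ := h x hx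
    simp only [mem_iUnion]
    exact ⟨K, j, s, hF, hxF⟩
  rw [hΓ]
  exact .iUnion fun K => .iUnion fun j => .iUnion fun s => .iUnion fun _ =>
    ((Box.isCompact_Icc _).image (continuous_facePoint _ j s)).measurableSet

theorem exists_forall_mul_l2norm_sq_le_formA (k : ℕ) {β₀ β₁ κ : ℝ} (hβ₀ : threshold k β₁ κ < β₀)
    (hconn : IsPreconnected Ω) (hdisj : Disjoint Γ Ω) (hne : Γ.Nonempty) {T₀ : RectMesh Ω}
    (hT₀ : T₀.Resolves Γ) :
    ∃ α : ℝ, 0 < α ∧ ∀ T : RectMesh Ω, T.RatioBound κ → ∀ v : T.Space k,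
      α * l2norm v ^ 2 ≤ formA Γ β₀ β₁ v v := by
  have hΓ := hT₀.measurableSet
  obtain ⟨C, hC⟩ := exists_l2norm_sq_le_mul_energy hconn hΓ hdisj hne hT₀ k
  obtain ⟨β', hlt, hβ'⟩ := exists_between hβ₀
  have hpos : 0 < β' := (zero_lt_one.trans (one_lt_threshold k β₁ κ)).trans hlt
  set γ := min (1 - threshold k β₁ κ / β') (β₀ - β')
  have hγ : 0 < γ := lt_min (sub_pos.mpr ((div_lt_one hpos).mpr hlt)) (sub_pos.mpr hβ')
  have hC₁ : 0 < max C 1 := lt_max_of_lt_right one_pos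
  refine ⟨γ / max C 1, div_pos hγ hC₁, fun T hT v => ?_⟩
  calc γ / max C 1 * l2norm v ^ 2 ≤ γ / max C 1 * (max C 1 * energy Γ v) := by
        gcongr
        exact (hC T v).trans (mul_le_mul_of_nonneg_right (le_max_left C 1) (energy_nonneg hΓ v))
    _ = γ * energy Γ v := by field_simp
    _ ≤ formA Γ β₀ β₁ v v := min_mul_energy_le_formA hΓ hdisj hT hpos v

section Coercive

variable {β₀ β₁ α : ℝ} (hα : 0 < α)
  (hcoer : ∀ v : T.Space k, α * l2norm v ^ 2 ≤ formA Γ β₀ β₁ v v)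
  {m : ℕ} (q : Fin m → ℝ) {ρ₀ ψD σ : (Fin (n + 1) → ℝ) → ℝ} (hρ : IntegrableOn ρ₀ Ω)
include hα hcoer hρ

theorem existsUnique_isSolution (hΓ : MeasurableSet Γ) (hψ : T.BoundaryIntegrable Γ ψD)
    (hσ : T.BoundaryIntegrable (frontier Ω \ Γ) σ) (c : Fin m → T.Space k) :
    ∃! ψ : T.Space k, IsSolution Γ β₀ β₁ q ρ₀ ψD σ c ψ := by
  have hdef : ∀ v, bilinA T k Γ β₀ β₁ v v = 0 → v = 0 := fun v hv => by
    have hle : α * l2norm v ^ 2 ≤ 0 := (hcoer v).trans_eq hv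
    exact eq_zero_of_l2norm_eq_zero (pow_eq_zero_iff two_ne_zero |>.mp
      (le_antisymm (nonpos_of_mul_nonpos_right hle hα) (sq_nonneg _)))
  have hL := existsUnique_of_apply_self_eq_zero (bilinA T k Γ β₀ β₁) hdef
    (linearOfSmulAdd (formL Γ β₀ q ρ₀ ψD σ c) (formL_smul_add q hρ hΓ β₀ hψ hσ c))
  exact (existsUnique_congr fun ψ => LinearMap.ext_iff).mp hL

theorem IsSolution.l2norm_sub_le {c c' : Fin m → T.Space k} {ψ ψ' : T.Space k}
    (hψ : IsSolution Γ β₀ β₁ q ρ₀ ψD σ c ψ) (hψ' : IsSolution Γ β₀ β₁ q ρ₀ ψD σ c' ψ') :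
    l2norm (ψ - ψ') ≤ α⁻¹ * ∑ i, |q i| * l2norm (c i - c' i) := by
  set e := ψ - ψ'
  set N := ∑ i, |q i| * l2norm (c i - c' i)
  have hsub : formA Γ β₀ β₁ e e = formA Γ β₀ β₁ ψ e - formA Γ β₀ β₁ ψ' e :=
    LinearMap.congr_fun ((bilinA T k Γ β₀ β₁).map_sub ψ ψ') e
  have hA : α * l2norm e ^ 2 ≤ N * l2norm e := by
    refine (hcoer e).trans ?_
    rw [hsub, hψ e, hψ' e]
    exact formL_sub_le β₀ q hρ c c' e
  rw [inv_mul_eq_div, le_div_iff₀' hα]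
  rcases (l2norm_nonneg e).eq_or_lt' with h0 | hpos
  · rw [h0, mul_zero]
    exact Finset.sum_nonneg fun i _ => mul_nonneg (abs_nonneg _) (l2norm_nonneg _)
  · exact le_of_mul_le_mul_right (by linarith) hpos

end Coercive

end RectMesh

end DDG

end

theorem theorem3p2_general (n k : ℕ) (β₁ κ : ℝ) :
    ∃ βstar : ℝ, 1 < βstar ∧
      (κ = 1 → 1 ≤ k → βstar = max (DDG.Gam k β₁) (2 * DDG.Gam k 0)) ∧
      ∀ β₀ : ℝ, βstar < β₀ →
        ∀ Ω : Set (Fin (n + 1) → ℝ), IsPreconnected Ω →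
          ∀ ΓD : Set (Fin (n + 1) → ℝ), ΓD ⊆ frontier Ω → ΓD.Nonempty →
            ∃ C : ℝ, 0 < C ∧
              ∀ T : DDG.RectMesh Ω, T.RatioBound κ → T.Resolves ΓD →
                ∀ (m : ℕ) (q : Fin m → ℝ) (ρ₀ ψD σ : (Fin (n + 1) → ℝ) → ℝ),
                  IntegrableOn ρ₀ Ω → T.BoundaryIntegrable ΓD ψD →
                  T.BoundaryIntegrable (frontier Ω \ ΓD) σ →
                    (∀ c : Fin m → T.Space k,
                      ∃! ψ : T.Space k, DDG.RectMesh.IsSolution ΓD β₀ β₁ q ρ₀ ψD σ c ψ) ∧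
                    ∀ (c c' : Fin m → T.Space k) (ψ ψ' : T.Space k),
                      DDG.RectMesh.IsSolution ΓD β₀ β₁ q ρ₀ ψD σ c ψ →
                      DDG.RectMesh.IsSolution ΓD β₀ β₁ q ρ₀ ψD σ c' ψ' →
                        DDG.RectMesh.l2norm (ψ - ψ') ≤
                          C * ∑ i, |q i| * DDG.RectMesh.l2norm (c i - c' i) := by
  refine ⟨DDG.threshold k β₁ κ, DDG.one_lt_threshold k β₁ κ, ?_, ?_⟩
  · rintro rfl hk
    exact DDG.threshold_one hk β₁
  intro β₀ hβ₀ Ω hconn ΓD hΓ hne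
  rcases em (∃ T₀ : DDG.RectMesh Ω, T₀.Resolves ΓD) with ⟨T₀, hT₀⟩ | hnone
  · have hdisj : Disjoint ΓD Ω := (disjoint_frontier_iff_isOpen.mpr T₀.isOpen).mono_left hΓ
    obtain ⟨α, hα, hcoer⟩ :=
      DDG.RectMesh.exists_forall_mul_l2norm_sq_le_formA k hβ₀ hconn hdisj hne hT₀
    exact ⟨α⁻¹, inv_pos.mpr hα, fun T hT hres m q ρ₀ ψD σ hρ hψD hσ =>
      ⟨DDG.RectMesh.existsUnique_isSolution hα (hcoer T hT) q hρ hres.measurableSet hψD hσ,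
        fun _ _ _ _ => DDG.RectMesh.IsSolution.l2norm_sub_le hα (hcoer T hT) q hρ⟩⟩
  · exact ⟨1, one_pos, fun T _ hres => (hnone ⟨T, hres⟩).elim⟩

theorem theorem3p2 (n k : ℕ) (β₁ κ : ℝ) :
    ∃ βstar : ℝ, 1 < βstar ∧
      (κ = 1 → n + 1 ≤ 2 → 1 ≤ k → βstar = max (DDG.Gam k β₁) (2 * DDG.Gam k 0)) ∧
      ∀ β₀ : ℝ, βstar < β₀ →
        ∀ Ω : Set (Fin (n + 1) → ℝ), IsOpen Ω → IsConnected Ω → Bornology.IsBounded Ω →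
          ∀ ΓD : Set (Fin (n + 1) → ℝ), ΓD ⊆ frontier Ω → ΓD.Nonempty →
            ∃ C : ℝ, 0 < C ∧
              ∀ T : DDG.RectMesh Ω, T.RatioBound κ → T.Resolves ΓD →
                ∀ (m : ℕ) (q : Fin m → ℝ) (ρ₀ ψD σ : (Fin (n + 1) → ℝ) → ℝ),
                  IntegrableOn ρ₀ Ω → T.BoundaryIntegrable ΓD ψD →
                  T.BoundaryIntegrable (frontier Ω \ ΓD) σ →
                    (∀ c : Fin m → T.Space k,
                      ∃! ψ : T.Space k, DDG.RectMesh.IsSolution ΓD β₀ β₁ q ρ₀ ψD σ c ψ) ∧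
                    ∀ (c c' : Fin m → T.Space k) (ψ ψ' : T.Space k),
                      DDG.RectMesh.IsSolution ΓD β₀ β₁ q ρ₀ ψD σ c ψ →
                      DDG.RectMesh.IsSolution ΓD β₀ β₁ q ρ₀ ψD σ c' ψ' →
                        DDG.RectMesh.l2norm (ψ - ψ') ≤
                          C * ∑ i, |q i| * DDG.RectMesh.l2norm (c i - c' i) := by
  obtain ⟨βstar, hone, hsharp, h⟩ := theorem3p2_general n k β₁ κ
  exact ⟨βstar, hone, fun hκ _ => hsharp hκ,
    fun β₀ hβ₀ Ω _ hconn _ => h β₀ hβ₀ Ω hconn.isPreconnected⟩
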